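/- Let $\ell>0$, $T>0$, and let $\rho,\sigma\in H^2(0,\ell)$, $q\in H^1(0,\ell)$ be real functions such that, for some constants $\rho_0,\sigma_0>0$, $\rho\ge\rho_0$, $\sigma\ge\sigma_0$ and $q\ge 0$ on $[0,\ell]$. Let $L^2_\rho(0,\ell)$ be the Hilbert space of complex-valued functions that are square integrable with respect to $\rho(x)\,dx$, and let $\mathcal A$ be the operator in $L^2_\rho(0,\ell)$ given by $$\mathcal A y=\rho^{-1}\big((\sigma y'')''-(qy')'\big),\qquad \mathcal D(\mathcal A)=\{y\in H^4(0,\ell): y(0)=y'(0)=y(\ell)=y'(\ell)=0\}.$$ Then $L^2_\rho(0,\ell)$ has an orthonormal basis $(\Phi_n)_{n\ge1}$ of eigenfunctions of $\mathcal A$, $\mathcal A\Phi_n=\lambda_n\Phi_n$, with $0<\lambda_1\le\lambda_2\le\dots\to+\infty$. For $\theta\in\mathbb R$ let $\mathcal A^\theta$ be the power of $\mathcal A$ defined by its spectral decomposition (i.e. $\mathcal A^\theta u=\sum_r r^\theta P_r u$, where $P_r$ is the orthogonal projection onto $\ker(\mathcal A-r)$, on the domain of all $u$ for which the series converges), and let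 $\mathcal H_\theta$ be $\mathcal D(\mathcal A^\theta)$ with the norm $\|u\|_\theta=\|\mathcal A^\theta u\|_{L^2_\rho(0,\ell)}$ if $\theta\ge0$, and the completion of $L^2_\rho(0,\ell)$ for this norm if $\theta<0$. For $\varphi\in\mathcal D(\mathcal A^\infty)=\bigcap_k\mathcal D(\mathcal A^k)$ let $\langle\cdot,\varphi\rangle$ denote the continuous extension to $\mathcal H_\theta$ of the inner product of $L^2_\rho(0,\ell)$. Let $\theta\in\mathbb R$ and $y^0\in\mathcal H_\theta$. Then the clamped problem $$\begin{cases} i\rho\,\partial_t y=-\partial_x^2(\sigma\,\partial_x^2y)+\partial_x(q\,\partial_xy), & (t,x)\in(0,T)\times(0,\ell),\\ y(t,0)=\partial_xy(t,0)=y(t,\ell)=\partial_xy(t,\ell)=0,& t\in(0,T),\\ y(0,\cdot)=y^0\end{cases}$$ has a unique solution $y\in C([0,T];\mathcal H_\theta)$. Here a solution is a function $y\in C([0,T];\mathcal H_\theta)$ with $y(0)=y^0$ such that, for all $\varphi\in\mathcal D(\mathcal A^\infty)$, the function $t\mapsto\langle y(t),\varphi\rangle$ is differentiable on $(0,T)$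 with $\frac{d}{dt}\langle y(t),\varphi\rangle=i\langle y(t),\mathcal A\varphi\rangle$. For every orthonormal basis $(\Phi_n)$ of eigenfunctions of $\mathcal A$ with nondecreasing sequence of eigenvalues $(\lambda_n)$, one has $\Phi_n\in\mathcal D(\mathcal A^\theta)$ for all $n$, the initial datum can be written as $y^0=\sum_n c_n\Phi_n$ with $c_n\in\mathbb C$ (convergence in $\mathcal H_\theta$), and for any such $(c_n)$ and all $t\in[0,T]$ $$y(t)=\sum_{n} c_n e^{i\lambda_n t}\,\Phi_n\qquad\text{in }\mathcal H_\theta .$$ Moreover the energy is conserved: $\|y(t)\|_\theta^2=\|y^0\|_\theta^2$ for all $t\in[0,T]$. -/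

import Mathlib

open MeasureTheory

noncomputable section

/-! ### Sobolev spaces on `(0, ℓ)` -/

/-- `f` is absolutely continuous on `[0, ℓ]` with (weak, a.e.) derivative `g ∈ L¹(0, ℓ)`. -/
def HasACDeriv {E : Type*} [NormedAddCommGroup E] [NormedSpace ℝ E] (ℓ : ℝ) (f g : ℝ → E) : Prop :=
  IntegrableOn g (Set.Ioo 0 ℓ) ∧ ∀ x ∈ Set.Icc 0 ℓ, f x = f 0 + ∫ t in (0 : ℝ)..x, g t

/-- `D 0, …, D k` are a function in `H^k(0, ℓ)` and its derivatives of order `1, …, k`. For `j < k`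
the function `D j` is the continuous representative on `[0, ℓ]`. -/
def IsSobolevJet {E : Type*} [NormedAddCommGroup E] [NormedSpace ℝ E] (ℓ : ℝ) (k : ℕ)
    (D : ℕ → ℝ → E) : Prop :=
  (∀ j < k, HasACDeriv ℓ (D j) (D (j + 1))) ∧
    ∀ j ≤ k, MemLp (D j) 2 (volume.restrict (Set.Ioo 0 ℓ))

/-- `f ∈ H^k(0, ℓ)` (for `k ≥ 1`: `f` is the continuous representative on `[0, ℓ]`). -/
def MemSobolev {E : Type*} [NormedAddCommGroup E] [NormedSpace ℝ E] (ℓ : ℝ) (k : ℕ)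
    (f : ℝ → E) : Prop :=
  ∃ D : ℕ → ℝ → E, D 0 = f ∧ IsSobolevJet ℓ k D

section SobolevLemmas

variable {E : Type*} [NormedAddCommGroup E] [NormedSpace ℝ E] {ℓ : ℝ}

theorem HasACDeriv.add {f g f' g' : ℝ → E} (h : HasACDeriv ℓ f g) (h' : HasACDeriv ℓ f' g') :
    HasACDeriv ℓ (f + f') (g + g') := by
  refine ⟨h.1.add h'.1, fun x hx => ?_⟩
  have key : ∀ k : ℝ → E, IntegrableOn k (Set.Ioo 0 ℓ) → IntervalIntegrable k volume 0 x := by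
    intro k hk
    rw [intervalIntegrable_iff_integrableOn_Ioo_of_le hx.1]
    exact hk.mono_set (Set.Ioo_subset_Ioo_right hx.2)
  have := intervalIntegral.integral_add (key g h.1) (key g' h'.1)
  simp only [Pi.add_apply]
  rw [this, h.2 x hx, h'.2 x hx]
  abel

theorem HasACDeriv.const_smul {f g : ℝ → ℂ} (c : ℂ) (h : HasACDeriv ℓ f g) :
    HasACDeriv ℓ (c • f) (c • g) := by
  refine ⟨h.1.smul c, fun x hx => ?_⟩
  have := intervalIntegral.integral_smul (a := 0) (b := x) (μ := volume) c g
  simp only [Pi.smul_apply]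
  rw [this, h.2 x hx, smul_add]

theorem IsSobolevJet.add {k : ℕ} {D D' : ℕ → ℝ → E} (h : IsSobolevJet ℓ k D)
    (h' : IsSobolevJet ℓ k D') : IsSobolevJet ℓ k (D + D') :=
  ⟨fun j hj => (h.1 j hj).add (h'.1 j hj), fun j hj => (h.2 j hj).add (h'.2 j hj)⟩

theorem IsSobolevJet.const_smul {k : ℕ} {D : ℕ → ℝ → ℂ} (c : ℂ) (h : IsSobolevJet ℓ k D) :
    IsSobolevJet ℓ k (c • D) :=
  ⟨fun j hj => (h.1 j hj).const_smul c, fun j hj => (h.2 j hj).const_smul c⟩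

end SobolevLemmas

/-! ### The clamped operator on `L²_ρ(0, ℓ)` -/

/-- The measure `ρ(x) dx` on `(0, ℓ)`. -/
def weightMeasure (ℓ : ℝ) (ρ : ℝ → ℝ) : Measure ℝ :=
  (volume.restrict (Set.Ioo 0 ℓ)).withDensity fun x => ENNReal.ofReal (ρ x)

/-- The Hilbert space `L²_ρ(0, ℓ)` of complex-valued functions. -/
abbrev WeightedL2 (ℓ : ℝ) (ρ : ℝ → ℝ) : Type := Lp ℂ 2 (weightMeasure ℓ ρ)

/-- The pairs `(y, v)` with `y ∈ H⁴(0, ℓ)`, `y(0) = y'(0) = y(ℓ) = y'(ℓ) = 0` and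
`v = ρ⁻¹ ((σ y'')'' - (q y')')`. Here `Y`, `W`, `Q` list the derivatives of `y`, of `σ y''`
and of `q y'`. -/
def clampedGraph (ℓ : ℝ) (ρ σ q : ℝ → ℝ) :
    Submodule ℂ (WeightedL2 ℓ ρ × WeightedL2 ℓ ρ) where
  carrier := {p | ∃ Y W Q : ℕ → ℝ → ℂ,
    IsSobolevJet ℓ 4 Y ∧
    (Y 0 0 = 0 ∧ Y 1 0 = 0 ∧ Y 0 ℓ = 0 ∧ Y 1 ℓ = 0) ∧
    (IsSobolevJet ℓ 2 W ∧ ∀ x, W 0 x = (σ x : ℂ) * Y 2 x) ∧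
    (IsSobolevJet ℓ 1 Q ∧ ∀ x, Q 0 x = (q x : ℂ) * Y 1 x) ∧
    (p.1 : ℝ → ℂ) =ᵐ[weightMeasure ℓ ρ] Y 0 ∧
    (p.2 : ℝ → ℂ) =ᵐ[weightMeasure ℓ ρ] fun x => (ρ x : ℂ)⁻¹ * (W 2 x - Q 1 x)}
  zero_mem' := by
    have hz : ∀ k, IsSobolevJet ℓ k (0 : ℕ → ℝ → ℂ) := fun k =>
      ⟨fun j _ => ⟨integrableOn_zero, fun x _ => by simp⟩, fun j _ => MemLp.zero⟩
    refine ⟨0, 0, 0, hz 4, by simp, ⟨hz 2, by simp⟩, ⟨hz 1, by simp⟩, ?_, ?_⟩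
    · exact Lp.coeFn_zero _ _ _
    · filter_upwards [Lp.coeFn_zero ℂ 2 (weightMeasure ℓ ρ)] with x hx
      simpa using hx
  add_mem' := by
    rintro p p' ⟨Y, W, Q, hY, hb, hW, hQ, h1, h2⟩ ⟨Y', W', Q', hY', hb', hW', hQ', h1', h2'⟩
    refine ⟨Y + Y', W + W', Q + Q', hY.add hY', ?_, ⟨hW.1.add hW'.1, fun x => ?_⟩,
      ⟨hQ.1.add hQ'.1, fun x => ?_⟩, ?_, ?_⟩
    · simp [hb.1, hb.2.1, hb.2.2.1, hb.2.2.2, hb'.1, hb'.2.1, hb'.2.2.1, hb'.2.2.2]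
    · simp only [Pi.add_apply, hW.2, hW'.2]; ring
    · simp only [Pi.add_apply, hQ.2, hQ'.2]; ring
    · filter_upwards [Lp.coeFn_add p.1 p'.1, h1, h1'] with x hx h h'
      simp only [Prod.fst_add, hx, Pi.add_apply, h, h']
    · filter_upwards [Lp.coeFn_add p.2 p'.2, h2, h2'] with x hx h h'
      simp only [Prod.snd_add, hx, Pi.add_apply, h, h']; ring
  smul_mem' := by
    rintro c p ⟨Y, W, Q, hY, hb, hW, hQ, h1, h2⟩
    refine ⟨c • Y, c • W, c • Q, hY.const_smul c, ?_, ⟨hW.1.const_smul c, fun x => ?_⟩,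
      ⟨hQ.1.const_smul c, fun x => ?_⟩, ?_, ?_⟩
    · simp [hb.1, hb.2.1, hb.2.2.1, hb.2.2.2]
    · simp only [Pi.smul_apply, smul_eq_mul, hW.2]; ring
    · simp only [Pi.smul_apply, smul_eq_mul, hQ.2]; ring
    · filter_upwards [Lp.coeFn_smul c p.1, h1] with x hx h
      simp only [Prod.smul_fst, hx, Pi.smul_apply, h]
    · filter_upwards [Lp.coeFn_smul c p.2, h2] with x hx h
      simp only [Prod.smul_snd, hx, Pi.smul_apply, h, smul_eq_mul]; ring

/-- The operator `𝒜 y = ρ⁻¹ ((σ y'')'' - (q y')')` in `L²_ρ(0, ℓ)` with domain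
`H⁴(0, ℓ) ∩ H²₀(0, ℓ)`. -/
def clampedOperator (ℓ : ℝ) (ρ σ q : ℝ → ℝ) : WeightedL2 ℓ ρ →ₗ.[ℂ] WeightedL2 ℓ ρ :=
  (clampedGraph ℓ ρ σ q).toLinearPMap

/-! ### Real powers and the scale of spaces generated by an operator

The definitions below are meant for a positive self-adjoint operator `A` that has an orthonormal
basis of eigenvectors. -/

section Scale

variable {H : Type*} [NormedAddCommGroup H] [InnerProductSpace ℂ H]

/-- The eigenspace `ker (A - r)`. -/
def eigSpace (A : H →ₗ.[ℂ] H) (r : ℝ) : Submodule ℂ H where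
  carrier := {u | ∃ h : u ∈ A.domain, A ⟨u, h⟩ = (r : ℂ) • u}
  zero_mem' := ⟨A.domain.zero_mem, by
    have : (⟨0, A.domain.zero_mem⟩ : A.domain) = 0 := rfl
    rw [this, LinearPMap.map_zero, smul_zero]⟩
  add_mem' := by
    rintro u v ⟨hu, hu'⟩ ⟨hv, hv'⟩
    refine ⟨A.domain.add_mem hu hv, ?_⟩
    have : (⟨u + v, A.domain.add_mem hu hv⟩ : A.domain) = ⟨u, hu⟩ + ⟨v, hv⟩ := rfl
    rw [this, LinearPMap.map_add, hu', hv', smul_add]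
  smul_mem' := by
    rintro c u ⟨hu, hu'⟩
    refine ⟨A.domain.smul_mem c hu, ?_⟩
    have : (⟨c • u, A.domain.smul_mem c hu⟩ : A.domain) = c • ⟨u, hu⟩ := rfl
    rw [this, LinearPMap.map_smul, hu', smul_comm]

/-- `D(A^∞)`, the intersection of the domains of the iterates of `A`: the vectors `φ` for which
`φ, Aφ, A²φ, …` are all defined. -/
def smoothVectors (A : H →ₗ.[ℂ] H) : Set H :=
  {φ | ∃ f : ℕ → H, f 0 = φ ∧ ∀ k, ∃ h : f k ∈ A.domain, A ⟨f k, h⟩ = f (k + 1)}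

theorem smoothVectors_subset_domain (A : H →ₗ.[ℂ] H) {φ : H} (hφ : φ ∈ smoothVectors A) :
    φ ∈ A.domain := by
  obtain ⟨f, rfl, hf⟩ := hφ
  exact (hf 0).1

variable [CompleteSpace H]

/-- The orthogonal projection onto the (closure of the) eigenspace `ker (A - r)`. -/
def eigProj (A : H →ₗ.[ℂ] H) (r : ℝ) : H →L[ℂ] H :=
  (eigSpace A r).topologicalClosure.starProjection

/-- The power `A^θ u = ∑_r r^θ P_r u`, the sum being over the eigenvalues `r` of `A` (`P_r = 0` for
all other `r`), on the domain of all `u` for which this series converges in `H`. -/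
def opPow (A : H →ₗ.[ℂ] H) (θ : ℝ) : H →ₗ.[ℂ] H where
  domain :=
    { carrier := {u | Summable fun r : ℝ => ((r ^ θ : ℝ) : ℂ) • eigProj A r u}
      zero_mem' := by simp [summable_zero]
      add_mem' := fun {u v} hu hv => by
        simpa only [Set.mem_ofPred_eq, map_add, smul_add] using hu.add hv
      smul_mem' := fun c u hu => by
        have := Summable.const_smul c hu
        simpa only [Set.mem_ofPred_eq, map_smul, smul_comm c] using this }
  toFun :=
    { toFun := fun u => ∑' r : ℝ, ((r ^ θ : ℝ) : ℂ) • eigProj A r (u : H)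
      map_add' := fun u v => by
        have := u.2.tsum_add v.2
        simpa only [Submodule.coe_add, map_add, smul_add] using this
      map_smul' := fun c u => by
        have := u.2.tsum_const_smul c
        simpa only [Submodule.coe_smul, map_smul, smul_comm c, RingHom.id_apply] using this }

/-- The domain of `A^θ`, to be equipped with the norm `‖A^θ u‖`. -/
def PreScale (A : H →ₗ.[ℂ] H) (θ : ℝ) : Type _ := ↥(opPow A θ).domain

instance (A : H →ₗ.[ℂ] H) (θ : ℝ) : AddCommGroup (PreScale A θ) :=
  inferInstanceAs (AddCommGroup ↥(opPow A θ).domain)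

instance (A : H →ₗ.[ℂ] H) (θ : ℝ) : Module ℂ (PreScale A θ) :=
  inferInstanceAs (Module ℂ ↥(opPow A θ).domain)

/-- `u ↦ A^θ u` on `D(A^θ)`. -/
def PreScale.pow (A : H →ₗ.[ℂ] H) (θ : ℝ) : PreScale A θ →ₗ[ℂ] H := (opPow A θ).toFun

instance (A : H →ₗ.[ℂ] H) (θ : ℝ) : SeminormedAddCommGroup (PreScale A θ) :=
  SeminormedAddCommGroup.induced _ _ (PreScale.pow A θ)

instance (A : H →ₗ.[ℂ] H) (θ : ℝ) : NormedSpace ℂ (PreScale A θ) :=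
  NormedSpace.induced ℂ _ _ (PreScale.pow A θ)

/-- The space `𝓗_θ`: the completion of `D(A^θ)` for the norm `‖A^θ u‖`. If `A` is positive
self-adjoint with a bounded inverse, then `D(A^θ)` is already complete for `θ ≥ 0`, so that `𝓗_θ`
is `D(A^θ)`, while `D(A^θ) = H` for `θ < 0`, so that `𝓗_θ` is the completion of `H`. -/
abbrev Scale (A : H →ₗ.[ℂ] H) (θ : ℝ) : Type _ := UniformSpace.Completion (PreScale A θ)

/-- An element of `D(A^θ) ⊆ H` as an element of `𝓗_θ`. -/
def toScale (A : H →ₗ.[ℂ] H) (θ : ℝ) (u : H) (hu : u ∈ (opPow A θ).domain) : Scale A θ :=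
  ((show PreScale A θ from ⟨u, hu⟩) : Scale A θ)

/-- The duality pairing of `u ∈ 𝓗_θ` with `φ ∈ D(A^∞)` (conjugate-linear in `φ`): the continuous
extension to `𝓗_θ` of the inner product `u ↦ ⟪φ, u⟫` of `H`. -/
def scalePairing (A : H →ₗ.[ℂ] H) (θ : ℝ) (φ : H) : Scale A θ → ℂ :=
  UniformSpace.Completion.extension fun u : PreScale A θ =>
    inner ℂ φ ((show ↥(opPow A θ).domain from u) : H)

/-- `y ∈ C([0, T]; 𝓗_θ)` is a (weak) solution of `i y_t = -A y` on `(0, T)` with `y(0) = y⁰`: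
for all `φ ∈ D(A^∞)` one has `d/dt ⟨y(t), φ⟩ = i ⟨y(t), A φ⟩` on `(0, T)`. -/
def IsSchrodingerSolution (A : H →ₗ.[ℂ] H) (θ : ℝ) {T : ℝ} (hT : 0 < T) (y₀ : Scale A θ)
    (y : C(Set.Icc (0 : ℝ) T, Scale A θ)) : Prop :=
  y ⟨0, Set.left_mem_Icc.mpr hT.le⟩ = y₀ ∧
  ∀ φ (hφ : φ ∈ smoothVectors A), ∀ t ∈ Set.Ioo (0 : ℝ) T,
    HasDerivAt (fun s => scalePairing A θ φ (y (Set.projIcc 0 T hT.le s)))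
      (Complex.I * scalePairing A θ (A ⟨φ, smoothVectors_subset_domain A hφ⟩)
        (y (Set.projIcc 0 T hT.le t))) t

/-- `Φ` is an orthonormal basis of `H` made of eigenvectors of `A`, with the nondecreasing sequence
of eigenvalues `lam`. -/
def IsEigenbasis (A : H →ₗ.[ℂ] H) (lam : ℕ → ℝ) (Φ : HilbertBasis ℕ ℂ H) : Prop :=
  Monotone lam ∧ ∀ n, Φ n ∈ eigSpace A (lam n)

end Scale

end

/-!
Write `w = y''` and let `J` be the Volterra operator. The clamped conditions say that `w` is
orthogonal to the affine functions, with `y = J (J w)`. Testing `(σ y'')'' - (q y')' = ρ f` against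
`J (J η)`, for `η` in this orthogonal complement, turns the equation into
`∫ σ w η̄ + ∫ q (J w) (J η)⁻ = ∫ ρ f (J (J η))⁻`, which is coercive since `σ ≥ σ₀ > 0` and `q ≥ 0`.
So `𝒜` is the inverse of a compact positive operator `f ↦ J (J w)`, and the spectral theorem gives
the eigenbasis.

The operator `𝒜^θ` extends to a unitary map from `𝓗_θ` onto `L²_ρ`, and the pairing of `u ∈ 𝓗_θ`
with `Φ_n` is, up to the factor `λ_n^{-θ}`, the `n`-th coefficient of its image. Along a solution
this coefficient satisfies `g' = i λ_n g`, so it is multiplied by `e^{iλ_n t}`: this gives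
uniqueness, the series and the conservation of the norm. Conversely, multiplying the coefficients by
`e^{iλ_n t}` gives a solution: the coefficients of `φ ∈ D(𝒜^∞)` decay faster than any power of
`λ_n`, so the pairing with `φ` can be differentiated term by term.
-/

noncomputable section

/-! ### Absolutely continuous functions on `[0, ℓ]` -/

/-- Lebesgue measure on `(0, ℓ)`. -/
abbrev intervalMeasure (ℓ : ℝ) : Measure ℝ := volume.restrict (Set.Ioo 0 ℓ)

section AbsolutelyContinuous

variable {ℓ : ℝ} {E : Type*} [NormedAddCommGroup E]

theorem intervalIntegrable_of_integrableOn_Ioo {g : ℝ → E} {a b : ℝ}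
    (hg : IntegrableOn g (Set.Ioo 0 ℓ)) (ha : a ∈ Set.Icc 0 ℓ) (hb : b ∈ Set.Icc 0 ℓ) :
    IntervalIntegrable g volume a b := by
  have hℓ : 0 ≤ ℓ := ha.1.trans ha.2
  refine ((intervalIntegrable_iff_integrableOn_Ioo_of_le hℓ).2 hg).mono_set ?_
  rw [Set.uIcc_of_le hℓ]
  exact Set.uIcc_subset_Icc ha hb

theorem absolutelyContinuousOnInterval_of_dist_le {X Y : Type*} [PseudoMetricSpace X]
    [PseudoMetricSpace Y] {f : ℝ → X} {g : ℝ → Y} {a b : ℝ} (K : ℝ)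
    (hf : AbsolutelyContinuousOnInterval f a b)
    (h : ∀ x ∈ Set.uIcc a b, ∀ y ∈ Set.uIcc a b, dist (g x) (g y) ≤ K * dist (f x) (f y)) :
    AbsolutelyContinuousOnInterval g a b := by
  have hK : Filter.Tendsto
      (fun I : ℕ × (ℕ → ℝ × ℝ) => K * ∑ i ∈ Finset.range I.1, dist (f (I.2 i).1) (f (I.2 i).2))
      (AbsolutelyContinuousOnInterval.totalLengthFilter ⊓
        .principal (AbsolutelyContinuousOnInterval.disjWithin a b)) (nhds 0) := by
    simpa only [mul_zero] using Filter.Tendsto.const_mul K hf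
  refine squeeze_zero' (.of_forall fun I => Finset.sum_nonneg fun _ _ => dist_nonneg) ?_ hK
  filter_upwards [Filter.mem_inf_of_right (Filter.mem_principal_self _)] with I hI
  rw [Finset.mul_sum]
  exact Finset.sum_le_sum fun i hi => h _ (hI.1 i hi).1 _ (hI.1 i hi).2

theorem eqOn_zero_of_ae_eq_zero {f : ℝ → E} (hf : ContinuousOn f (Set.Icc 0 ℓ)) (hℓ : 0 < ℓ)
    (h : f =ᵐ[intervalMeasure ℓ] 0) : Set.EqOn f 0 (Set.Icc 0 ℓ) := by
  rw [intervalMeasure, restrict_Ioo_eq_restrict_Icc] at h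
  exact Measure.eqOn_Icc_of_ae_eq volume hℓ.ne h hf continuousOn_const

theorem memLp_of_continuousOn {f : ℝ → E} (hf : ContinuousOn f (Set.Icc 0 ℓ)) (p : ENNReal) :
    MemLp f p (intervalMeasure ℓ) := by
  obtain ⟨C, hC⟩ := isCompact_Icc.exists_bound_of_continuousOn hf
  exact .of_bound ((hf.mono Set.Ioo_subset_Icc_self).aestronglyMeasurable measurableSet_Ioo) C
    (ae_restrict_of_forall_mem measurableSet_Ioo fun x hx => hC x (Set.Ioo_subset_Icc_self hx))

variable [NormedSpace ℝ E]

theorem intervalIntegral_congr_ae_Ioo {g g' : ℝ → E} (hg : g =ᵐ[intervalMeasure ℓ] g') {x : ℝ}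
    (hx : x ∈ Set.Icc 0 ℓ) : ∫ t in (0 : ℝ)..x, g t = ∫ t in (0 : ℝ)..x, g' t := by
  rw [intervalIntegral.integral_of_le hx.1, intervalIntegral.integral_of_le hx.1,
    integral_Ioc_eq_integral_Ioo, integral_Ioc_eq_integral_Ioo]
  exact integral_congr_ae (ae_restrict_of_ae_restrict_of_subset (Set.Ioo_subset_Ioo_right hx.2) hg)

theorem hasACDeriv_integral {g : ℝ → E} (c : E) (hg : IntegrableOn g (Set.Ioo 0 ℓ)) :
    HasACDeriv ℓ (fun x => c + ∫ t in (0 : ℝ)..x, g t) g :=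
  ⟨hg, fun x _ => by simp⟩

namespace HasACDeriv

variable {f f' g g' : ℝ → E}

theorem of_neg (f g : ℝ → E) (hℓ : ℓ < 0) : HasACDeriv ℓ f g := by
  simp [HasACDeriv, Set.Ioo_eq_empty_of_le hℓ.le, Set.Icc_eq_empty_of_lt hℓ]

theorem congr (h : HasACDeriv ℓ f g) (hf : Set.EqOn f' f (Set.Icc 0 ℓ))
    (hg : g' =ᵐ[intervalMeasure ℓ] g) : HasACDeriv ℓ f' g' := by
  refine ⟨Integrable.congr h.1 hg.symm, fun x hx => ?_⟩
  rw [hf hx, hf ⟨le_rfl, hx.1.trans hx.2⟩, h.2 x hx, intervalIntegral_congr_ae_Ioo hg hx]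

theorem const_add (h : HasACDeriv ℓ f g) (c : E) : HasACDeriv ℓ (fun x => c + f x) g :=
  ⟨h.1, fun x hx => by beta_reduce; rw [h.2 x hx, add_assoc]⟩

theorem sub_eq_integral (h : HasACDeriv ℓ f g) {x y : ℝ} (hx : x ∈ Set.Icc 0 ℓ)
    (hy : y ∈ Set.Icc 0 ℓ) : f y - f x = ∫ t in x..y, g t := by
  have h0 : (0 : ℝ) ∈ Set.Icc 0 ℓ := ⟨le_rfl, hx.1.trans hx.2⟩
  rw [h.2 x hx, h.2 y hy, add_sub_add_left_eq_sub]
  exact intervalIntegral.integral_interval_sub_left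
    (intervalIntegrable_of_integrableOn_Ioo h.1 h0 hy)
    (intervalIntegrable_of_integrableOn_Ioo h.1 h0 hx)

theorem absolutelyContinuousOnInterval (h : HasACDeriv ℓ f g) (hℓ : 0 ≤ ℓ) :
    AbsolutelyContinuousOnInterval f 0 ℓ := by
  have h0 : (0 : ℝ) ∈ Set.Icc 0 ℓ := ⟨le_rfl, hℓ⟩
  refine absolutelyContinuousOnInterval_of_dist_le 1
    ((intervalIntegrable_of_integrableOn_Ioo h.1.norm h0
      ⟨hℓ, le_rfl⟩).absolutelyContinuousOnInterval_intervalIntegral Set.left_mem_uIcc) ?_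
  rw [Set.uIcc_of_le hℓ]
  intro x hx y hy
  rw [dist_comm, dist_eq_norm, h.sub_eq_integral hx hy, one_mul, dist_comm, Real.dist_eq,
    intervalIntegral.integral_interval_sub_left
      (intervalIntegrable_of_integrableOn_Ioo h.1.norm h0 hy)
      (intervalIntegrable_of_integrableOn_Ioo h.1.norm h0 hx)]
  exact intervalIntegral.norm_integral_le_abs_integral_norm

theorem continuousOn (h : HasACDeriv ℓ f g) : ContinuousOn f (Set.Icc 0 ℓ) := by
  rcases lt_or_ge ℓ 0 with hℓ | hℓ
  · simp [Set.Icc_eq_empty_of_lt hℓ]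
  · simpa only [Set.uIcc_of_le hℓ] using (h.absolutelyContinuousOnInterval hℓ).continuousOn

variable [CompleteSpace E]

theorem ae_hasDerivAt (h : HasACDeriv ℓ f g) :
    ∀ᵐ x, x ∈ Set.Ioo 0 ℓ → HasDerivAt f (g x) x := by
  rcases le_or_gt ℓ 0 with hℓ | hℓ
  · simp [Set.Ioo_eq_empty_of_le hℓ]
  filter_upwards [(intervalIntegrable_of_integrableOn_Ioo h.1 ⟨le_rfl, hℓ.le⟩
    ⟨hℓ.le, le_rfl⟩).ae_hasDerivAt_integral] with x hx hx'
  have hx₁ : x ∈ Set.uIcc 0 ℓ := Set.Icc_subset_uIcc (Set.Ioo_subset_Icc_self hx')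
  refine ((hx hx₁ 0 Set.left_mem_uIcc).const_add (f 0)).congr_of_eventuallyEq ?_
  filter_upwards [Ioo_mem_nhds hx'.1 hx'.2] with y hy
  exact h.2 y (Set.Ioo_subset_Icc_self hy)

theorem of_absolutelyContinuousOnInterval (hf : AbsolutelyContinuousOnInterval f 0 ℓ)
    (hg : IntegrableOn g (Set.Ioo 0 ℓ)) (hfg : ∀ᵐ x, x ∈ Set.Ioo 0 ℓ → HasDerivAt f (g x) x) :
    HasACDeriv ℓ f g := by
  refine ⟨hg, fun x hx => ?_⟩
  have hℓ : 0 ≤ ℓ := hx.1.trans hx.2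
  have hI : HasACDeriv ℓ (fun x => f 0 + ∫ t in (0 : ℝ)..x, g t) g := hasACDeriv_integral _ hg
  have hderiv : ∀ᵐ y, y ∈ Set.uIcc 0 ℓ →
      HasDerivAt (f - fun x => f 0 + ∫ t in (0 : ℝ)..x, g t) 0 y := by
    filter_upwards [hfg, hI.ae_hasDerivAt, Ioo_ae_eq_Icc (μ := volume) (a := (0 : ℝ)) (b := ℓ)]
      with y h₁ h₂ h₃ hy
    rw [Set.uIcc_of_le hℓ] at hy
    have hy' : y ∈ Set.Ioo 0 ℓ := h₃.mpr hy
    simpa only [sub_self] using (h₁ hy').sub (h₂ hy')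
  obtain ⟨C, hC⟩ :=
    (hf.sub (hI.absolutelyContinuousOnInterval hℓ)).const_of_ae_hasDerivAt_zero hderiv
  rw [Set.uIcc_of_le hℓ] at hC
  have h0 : C = 0 := by rw [← hC 0 ⟨le_rfl, hℓ⟩]; simp
  exact sub_eq_zero.1 ((hC x hx).trans h0)

theorem clm_comp {F : Type*} [NormedAddCommGroup F] [NormedSpace ℝ F] [CompleteSpace F]
    (h : HasACDeriv ℓ f g) (L : E →L[ℝ] F) :
    HasACDeriv ℓ (fun x => L (f x)) (fun x => L (g x)) := by
  refine ⟨L.integrable_comp h.1, fun x hx => ?_⟩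
  have h0 : (0 : ℝ) ∈ Set.Icc 0 ℓ := ⟨le_rfl, hx.1.trans hx.2⟩
  beta_reduce
  rw [h.2 x hx, map_add,
    L.intervalIntegral_comp_comm (intervalIntegrable_of_integrableOn_Ioo h.1 h0 hx)]

theorem ae_eq_zero (h : HasACDeriv ℓ f g) (hf : Set.EqOn f 0 (Set.Icc 0 ℓ)) :
    g =ᵐ[intervalMeasure ℓ] 0 := by
  rw [Filter.EventuallyEq, ae_restrict_iff' measurableSet_Ioo]
  filter_upwards [h.ae_hasDerivAt] with x hx hx'
  refine (hx hx').unique ((hasDerivAt_const x (0 : E)).congr_of_eventuallyEq ?_)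
  filter_upwards [Ioo_mem_nhds hx'.1 hx'.2] with y hy
  exact hf (Set.Ioo_subset_Icc_self hy)

end HasACDeriv

section Algebra

variable {𝕜 : Type*} [RCLike 𝕜] {f f' g g' : ℝ → 𝕜}

theorem memLp_mul_of_continuousOn {p : ENNReal} (hf : ContinuousOn f (Set.Icc 0 ℓ))
    (hg : MemLp g p (intervalMeasure ℓ)) : MemLp (fun x => f x * g x) p (intervalMeasure ℓ) :=
  hg.mul' (memLp_of_continuousOn hf ⊤)

theorem integrableOn_mul_of_continuousOn (hf : ContinuousOn f (Set.Icc 0 ℓ))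
    (hg : IntegrableOn g (Set.Ioo 0 ℓ)) : IntegrableOn (fun x => f x * g x) (Set.Ioo 0 ℓ) :=
  memLp_one_iff_integrable.1 (memLp_mul_of_continuousOn hf (memLp_one_iff_integrable.2 hg))

namespace HasACDeriv

theorem mul (h : HasACDeriv ℓ f g) (h' : HasACDeriv ℓ f' g') :
    HasACDeriv ℓ (fun x => f x * f' x) (fun x => f' x * g x + f x * g' x) := by
  rcases lt_or_ge ℓ 0 with hℓ | hℓ
  · exact .of_neg _ _ hℓ
  refine .of_absolutelyContinuousOnInterval
    ((h.absolutelyContinuousOnInterval hℓ).smul (h'.absolutelyContinuousOnInterval hℓ))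
    ((integrableOn_mul_of_continuousOn h'.continuousOn h.1).add
      (integrableOn_mul_of_continuousOn h.continuousOn h'.1)) ?_
  filter_upwards [h.ae_hasDerivAt, h'.ae_hasDerivAt] with x h₁ h₂ hx
  rw [mul_comm (f' x)]
  exact (h₁ hx).mul (h₂ hx)

theorem inv (h : HasACDeriv ℓ f g) (hf : ∀ x ∈ Set.Icc 0 ℓ, f x ≠ 0) :
    HasACDeriv ℓ (fun x => (f x)⁻¹) (fun x => -((f x)⁻¹ * (f x)⁻¹ * g x)) := by
  rcases lt_or_ge ℓ 0 with hℓ | hℓ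
  · exact .of_neg _ _ hℓ
  have hc : ContinuousOn (fun x => (f x)⁻¹) (Set.Icc 0 ℓ) := h.continuousOn.inv₀ hf
  obtain ⟨C, hC⟩ := isCompact_Icc.exists_bound_of_continuousOn hc
  refine .of_absolutelyContinuousOnInterval (absolutelyContinuousOnInterval_of_dist_le (C * C)
    (h.absolutelyContinuousOnInterval hℓ) ?_)
    (integrableOn_mul_of_continuousOn (hc.mul hc) h.1).neg ?_
  · rw [Set.uIcc_of_le hℓ]
    intro x hx y hy
    have hxy : dist (f x)⁻¹ (f y)⁻¹ = ‖(f x)⁻¹‖ * ‖(f y)⁻¹‖ * dist (f x) (f y) := by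
      rw [dist_inv_inv₀ (hf x hx) (hf y hy), norm_inv, norm_inv]
      ring
    rw [hxy]
    gcongr
    exacts [(norm_nonneg _).trans (hC x hx), hC x hx, hC y hy]
  · filter_upwards [h.ae_hasDerivAt] with x h₁ hx
    exact ((h₁ hx).inv (hf x (Set.Ioo_subset_Icc_self hx))).congr_deriv (by
      rw [div_eq_mul_inv, sq, mul_inv]; ring)

end HasACDeriv

end Algebra

end AbsolutelyContinuous

/-! ### Sobolev functions on `(0, ℓ)` -/

section Sobolev

variable {ℓ : ℝ} {k : ℕ}

/-- The sequence `f, D 0, D 1, …`: when `D` lists the derivatives of `f'`, it lists those of `f`. -/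
def consJet {E : Type*} (f : ℝ → E) (D : ℕ → ℝ → E) : ℕ → ℝ → E := fun j => j.casesOn f D

theorem integrableOn_of_memLp_two {E : Type*} [NormedAddCommGroup E] {f : ℝ → E}
    (hf : MemLp f 2 (intervalMeasure ℓ)) : IntegrableOn f (Set.Ioo 0 ℓ) :=
  hf.integrable one_le_two

section NormedSpace

variable {E : Type*} [NormedAddCommGroup E] [NormedSpace ℝ E] {f g : ℝ → E} {D : ℕ → ℝ → E}

theorem IsSobolevJet.cons (hf : HasACDeriv ℓ f (D 0)) (hD : IsSobolevJet ℓ k D) :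
    IsSobolevJet ℓ (k + 1) (consJet f D) := by
  constructor
  · rintro (_ | j) hj
    exacts [hf, hD.1 j (by omega)]
  · rintro (_ | j) hj
    exacts [memLp_of_continuousOn hf.continuousOn 2, hD.2 j (by omega)]

theorem memSobolev_zero_iff : MemSobolev ℓ 0 f ↔ MemLp f 2 (intervalMeasure ℓ) := by
  constructor
  · rintro ⟨D, rfl, hD⟩
    exact hD.2 0 le_rfl
  · exact fun hf => ⟨fun _ => f, rfl, by simp, fun _ _ => hf⟩

theorem memSobolev_succ_iff :
    MemSobolev ℓ (k + 1) f ↔ ∃ g, HasACDeriv ℓ f g ∧ MemSobolev ℓ k g := by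
  constructor
  · rintro ⟨D, rfl, hD⟩
    exact ⟨D 1, hD.1 0 k.succ_pos, fun j => D (j + 1), rfl,
      fun j hj => hD.1 (j + 1) (by omega), fun j hj => hD.2 (j + 1) (by omega)⟩
  · rintro ⟨_, hf, D, rfl, hD⟩
    exact ⟨consJet f D, rfl, hD.cons hf⟩

theorem memSobolev_one_iff :
    MemSobolev ℓ 1 f ↔ ∃ g, HasACDeriv ℓ f g ∧ MemLp g 2 (intervalMeasure ℓ) := by
  simp only [memSobolev_succ_iff (k := 0), memSobolev_zero_iff]

namespace MemSobolev

theorem of_succ (hf : MemSobolev ℓ (k + 1) f) : MemSobolev ℓ k f := by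
  obtain ⟨D, rfl, hD⟩ := hf
  exact ⟨D, rfl, fun j hj => hD.1 j (by omega), fun j hj => hD.2 j (by omega)⟩

theorem continuousOn (hf : MemSobolev ℓ (k + 1) f) : ContinuousOn f (Set.Icc 0 ℓ) := by
  obtain ⟨g, hfg, -⟩ := memSobolev_succ_iff.1 hf
  exact hfg.continuousOn

theorem add (hf : MemSobolev ℓ k f) (hg : MemSobolev ℓ k g) :
    MemSobolev ℓ k (fun x => f x + g x) := by
  obtain ⟨D, rfl, hD⟩ := hf
  obtain ⟨D', rfl, hD'⟩ := hg
  exact ⟨D + D', rfl, hD.add hD'⟩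

theorem clm_comp {F : Type*} [NormedAddCommGroup F] [NormedSpace ℝ F] [CompleteSpace E]
    [CompleteSpace F] (hf : MemSobolev ℓ k f) (L : E →L[ℝ] F) :
    MemSobolev ℓ k (fun x => L (f x)) := by
  obtain ⟨D, rfl, hD⟩ := hf
  exact ⟨fun j x => L (D j x), rfl, fun j hj => (hD.1 j hj).clm_comp L,
    fun j hj => L.comp_memLp' (hD.2 j hj)⟩

end MemSobolev

end NormedSpace

namespace MemSobolev

variable {𝕜 : Type*} [RCLike 𝕜] {f g : ℝ → 𝕜}

theorem mul (hf : MemSobolev ℓ (k + 1) f) (hg : MemSobolev ℓ (k + 1) g) :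
    MemSobolev ℓ (k + 1) (fun x => f x * g x) := by
  induction k generalizing f g with
  | zero =>
    obtain ⟨f', hff', hf'⟩ := memSobolev_one_iff.1 hf
    obtain ⟨g', hgg', hg'⟩ := memSobolev_one_iff.1 hg
    exact memSobolev_one_iff.2 ⟨_, hff'.mul hgg',
      (memLp_mul_of_continuousOn hg.continuousOn hf').add
        (memLp_mul_of_continuousOn hf.continuousOn hg')⟩
  | succ k ih =>
    obtain ⟨f', hff', hf'⟩ := memSobolev_succ_iff.1 hf
    obtain ⟨g', hgg', hg'⟩ := memSobolev_succ_iff.1 hg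
    exact memSobolev_succ_iff.2 ⟨_, hff'.mul hgg', (ih hg.of_succ hf').add (ih hf.of_succ hg')⟩

theorem inv (hf : MemSobolev ℓ (k + 1) f) (h : ∀ x ∈ Set.Icc 0 ℓ, f x ≠ 0) :
    MemSobolev ℓ (k + 1) (fun x => (f x)⁻¹) := by
  induction k with
  | zero =>
    obtain ⟨f', hff', hf'⟩ := memSobolev_one_iff.1 hf
    have hc : ContinuousOn (fun x => (f x)⁻¹) (Set.Icc 0 ℓ) := hf.continuousOn.inv₀ h
    exact memSobolev_one_iff.2
      ⟨_, hff'.inv h, (memLp_mul_of_continuousOn (hc.mul hc) hf').neg⟩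
  | succ k ih =>
    obtain ⟨f', hff', hf'⟩ := memSobolev_succ_iff.1 hf
    have hinv := ih hf.of_succ
    exact memSobolev_succ_iff.2 ⟨_, hff'.inv h,
      ((hinv.mul hinv).mul hf').clm_comp (-ContinuousLinearMap.id ℝ 𝕜)⟩

end MemSobolev

end Sobolev

/-! ### Multiplication and Volterra operators -/

section Multiplication

variable {α : Type*} [MeasurableSpace α] {μ : Measure α} {m : α → ℝ}

/-- Multiplication by a bounded real function on `L²(μ)`. -/
def mulL2 (hm : MemLp m ⊤ μ) : Lp ℂ 2 μ →L[ℂ] Lp ℂ 2 μ :=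
  (ContinuousLinearMap.mul ℂ ℂ).holderL μ ⊤ 2 2 (MemLp.ofReal (K := ℂ) hm).toLp

theorem coeFn_mulL2 (hm : MemLp m ⊤ μ) (f : Lp ℂ 2 μ) :
    mulL2 hm f =ᵐ[μ] fun x => (m x : ℂ) * f x := by
  filter_upwards [(ContinuousLinearMap.mul ℂ ℂ).coeFn_holder (r := 2)
    (MemLp.ofReal (K := ℂ) hm).toLp f, (MemLp.ofReal (K := ℂ) hm).coeFn_toLp] with x hx hmx
  rw [mulL2, ContinuousLinearMap.holderL_apply_apply, hx, hmx]
  rfl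

theorem isSymmetric_mulL2 (hm : MemLp m ⊤ μ) : (mulL2 hm).IsSymmetric := fun f g => by
  change inner ℂ (mulL2 hm f) g = inner ℂ f (mulL2 hm g)
  rw [L2.inner_def, L2.inner_def]
  refine integral_congr_ae ?_
  filter_upwards [coeFn_mulL2 hm f, coeFn_mulL2 hm g] with x hf hg
  simp only [hf, hg, RCLike.inner_apply, map_mul, Complex.conj_ofReal]
  ring

theorem le_re_inner_mulL2 (hm : MemLp m ⊤ μ) {c : ℝ} (hc : ∀ᵐ x ∂μ, c ≤ m x) (f : Lp ℂ 2 μ) :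
    c * ‖f‖ ^ 2 ≤ (inner ℂ f (mulL2 hm f)).re := by
  rw [← inner_self_eq_norm_sq (𝕜 := ℂ), L2.inner_def, L2.inner_def, ← RCLike.re_eq_complex_re,
    ← integral_re (L2.integrable_inner _ _), ← integral_re (L2.integrable_inner _ _),
    ← integral_const_mul]
  refine integral_mono_ae ((L2.integrable_inner f f).re.const_mul c)
    (L2.integrable_inner f (mulL2 hm f)).re ?_
  filter_upwards [coeFn_mulL2 hm f, hc] with x hx hcx
  have hre : (inner ℂ (f x) ((m x : ℂ) * f x)).re = m x * (inner ℂ (f x) (f x)).re := by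
    rw [← smul_eq_mul, inner_smul_right, Complex.re_ofReal_mul]
  simp only [hx, RCLike.re_eq_complex_re, hre]
  exact mul_le_mul_of_nonneg_right hcx (inner_self_nonneg (𝕜 := ℂ) (x := f x))

end Multiplication

/-- The space `L²(0, ℓ)` of complex-valued functions. -/
abbrev IntervalL2 (ℓ : ℝ) : Type := Lp ℂ 2 (intervalMeasure ℓ)

section Volterra

variable {ℓ : ℝ}

theorem IntervalL2.integrableOn (f : IntervalL2 ℓ) : IntegrableOn f (Set.Ioo 0 ℓ) :=
  integrableOn_of_memLp_two (Lp.memLp f)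

theorem IntervalL2.norm_integral_le (f : IntervalL2 ℓ) {a b : ℝ} (ha : 0 ≤ a) (hab : a ≤ b)
    (hb : b ≤ ℓ) : ‖∫ t in a..b, f t‖ ≤ √(b - a) * ‖f‖ := by
  have hs : MeasurableSet (Set.Ioo a b) := measurableSet_Ioo
  have hμ : intervalMeasure ℓ (Set.Ioo a b) ≠ ⊤ := measure_ne_top _ _
  have hsub : Set.Ioo a b ⊆ Set.Ioo 0 ℓ := Set.Ioo_subset_Ioo ha hb
  have hinner : ∫ t in a..b, f t = inner ℂ (indicatorConstLp 2 hs hμ (1 : ℂ)) f := by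
    rw [L2.inner_indicatorConstLp_one, Measure.restrict_restrict hs,
      Set.inter_eq_self_of_subset_left hsub, intervalIntegral.integral_of_le hab,
      integral_Ioc_eq_integral_Ioo]
  rw [hinner]
  refine (norm_inner_le_norm _ _).trans_eq ?_
  rw [norm_indicatorConstLp (by norm_num) (by norm_num), measureReal_restrict_apply hs,
    Set.inter_eq_self_of_subset_left hsub, Real.volume_real_Ioo_of_le hab, norm_one, one_mul,
    Real.sqrt_eq_rpow]
  norm_num

theorem IntervalL2.norm_integral_sub_le (hℓ : 0 ≤ ℓ) (f : IntervalL2 ℓ) {x y : ℝ}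
    (hx : x ∈ Set.Icc 0 ℓ) (hy : y ∈ Set.Icc 0 ℓ) :
    ‖(∫ t in (0 : ℝ)..x, f t) - ∫ t in (0 : ℝ)..y, f t‖ ≤ √|x - y| * ‖f‖ := by
  have h0 : (0 : ℝ) ∈ Set.Icc 0 ℓ := ⟨le_rfl, hℓ⟩
  rw [intervalIntegral.integral_interval_sub_left
    (intervalIntegrable_of_integrableOn_Ioo f.integrableOn h0 hx)
    (intervalIntegrable_of_integrableOn_Ioo f.integrableOn h0 hy)]
  rcases le_total x y with h | h
  · rw [intervalIntegral.integral_symm, norm_neg, abs_sub_comm, abs_of_nonneg (sub_nonneg.2 h)]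
    exact f.norm_integral_le hx.1 h hy.2
  · rw [abs_of_nonneg (sub_nonneg.2 h)]
    exact f.norm_integral_le hy.1 h hx.2

theorem IntervalL2.hasACDeriv_integral (f : IntervalL2 ℓ) :
    HasACDeriv ℓ (fun x => ∫ t in (0 : ℝ)..x, f t) f := by
  simpa only [zero_add] using _root_.hasACDeriv_integral 0 f.integrableOn

open scoped BoundedContinuousFunction

/-- The operator `f ↦ ∫₀ˣ f` from `L²(0, ℓ)` to `C([0, ℓ])`. -/
def volterraCont (hℓ : 0 ≤ ℓ) : IntervalL2 ℓ →L[ℂ] (Set.Icc (0 : ℝ) ℓ →ᵇ ℂ) :=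
  LinearMap.mkContinuous
    { toFun := fun f => BoundedContinuousFunction.mkOfCompact
        ⟨fun x => ∫ t in (0 : ℝ)..x, f t,
          continuousOn_iff_continuous_domRestrict.1 f.hasACDeriv_integral.continuousOn⟩
      map_add' := fun f g => by
        ext x
        have h0 : (0 : ℝ) ∈ Set.Icc 0 ℓ := ⟨le_rfl, hℓ⟩
        change ∫ t in (0 : ℝ)..x, (f + g : IntervalL2 ℓ) t =
          (∫ t in (0 : ℝ)..x, f t) + ∫ t in (0 : ℝ)..x, g t
        rw [intervalIntegral_congr_ae_Ioo (Lp.coeFn_add f g) x.2, ← intervalIntegral.integral_add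
          (intervalIntegrable_of_integrableOn_Ioo f.integrableOn h0 x.2)
          (intervalIntegrable_of_integrableOn_Ioo g.integrableOn h0 x.2)]
        rfl
      map_smul' := fun c f => by
        ext x
        change ∫ t in (0 : ℝ)..x, (c • f : IntervalL2 ℓ) t = c • ∫ t in (0 : ℝ)..x, f t
        rw [intervalIntegral_congr_ae_Ioo (Lp.coeFn_smul c f) x.2,
          ← intervalIntegral.integral_smul]
        rfl }
    (√ℓ) (fun f => by
      refine (BoundedContinuousFunction.norm_le (by positivity)).2 fun x => ?_
      refine (f.norm_integral_le le_rfl x.2.1 x.2.2).trans ?_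
      gcongr
      linarith [x.2.2])

theorem isCompactOperator_volterraCont (hℓ : 0 ≤ ℓ) : IsCompactOperator (volterraCont hℓ) := by
  refine (isCompactOperator_iff_isCompact_closure_image_closedBall
    (volterraCont hℓ).toLinearMap one_pos).2 ?_
  refine BoundedContinuousFunction.arzela_ascoli (Metric.closedBall (0 : ℂ) ‖volterraCont hℓ‖)
    (isCompact_closedBall _ _) _ ?_ ?_
  · rintro _ x ⟨f, hf, rfl⟩
    rw [mem_closedBall_zero_iff] at hf ⊢
    refine (BoundedContinuousFunction.norm_coe_le_norm _ x).trans ?_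
    refine ((volterraCont hℓ).le_opNorm f).trans ?_
    exact mul_le_of_le_one_right (norm_nonneg _) hf
  · refine Metric.equicontinuous_of_continuity_modulus (fun d => √d) ?_ _ ?_
    · simpa using Real.continuous_sqrt.tendsto 0
    · rintro x y ⟨_, f, hf, rfl⟩
      rw [mem_closedBall_zero_iff] at hf
      rw [dist_eq_norm]
      refine (f.norm_integral_sub_le hℓ x.2 y.2).trans ?_
      exact mul_le_of_le_one_right (Real.sqrt_nonneg _) hf

/-- The embedding of `C([0, ℓ])` into `L²(μ)` for a finite measure `μ`, meant for `μ` carried by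
`[0, ℓ]`: a function on `[0, ℓ]` is extended by constants to the rest of the line. -/
def contToL2 (hℓ : 0 ≤ ℓ) (μ : Measure ℝ) [IsFiniteMeasure μ] :
    (Set.Icc (0 : ℝ) ℓ →ᵇ ℂ) →L[ℂ] Lp ℂ 2 μ :=
  (BoundedContinuousFunction.toLp 2 μ ℂ).comp (LinearMap.mkContinuous (σ := RingHom.id ℂ)
    { toFun := fun f => f.compContinuous ⟨Set.projIcc 0 ℓ hℓ, continuous_projIcc⟩
      map_add' := fun _ _ => rfl
      map_smul' := fun _ _ => rfl } 1 (fun f => by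
        rw [one_mul]
        exact (BoundedContinuousFunction.norm_le (norm_nonneg _)).2 fun x => f.norm_coe_le_norm _))

/-- The operator `f ↦ ∫₀ˣ f` from `L²(0, ℓ)` to `L²(μ)`, for a finite measure `μ` on `(0, ℓ)`. -/
def volterraInto (hℓ : 0 ≤ ℓ) (μ : Measure ℝ) [IsFiniteMeasure μ] : IntervalL2 ℓ →L[ℂ] Lp ℂ 2 μ :=
  (contToL2 hℓ μ).comp (volterraCont hℓ)

theorem coeFn_volterraInto (hℓ : 0 ≤ ℓ) {μ : Measure ℝ} [IsFiniteMeasure μ]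
    (hμ : μ ≪ intervalMeasure ℓ) (f : IntervalL2 ℓ) :
    volterraInto hℓ μ f =ᵐ[μ] fun x => ∫ t in (0 : ℝ)..x, f t := by
  filter_upwards [BoundedContinuousFunction.coeFn_toLp (p := 2) (𝕜 := ℂ) μ
      ((volterraCont hℓ f).compContinuous ⟨Set.projIcc 0 ℓ hℓ, continuous_projIcc⟩),
    hμ.ae_le (ae_restrict_mem measurableSet_Ioo)] with x hx hxℓ
  refine hx.trans ?_
  change ∫ t in (0 : ℝ)..(Set.projIcc 0 ℓ hℓ x : ℝ), f t = _
  rw [Set.projIcc_of_mem hℓ (Set.Ioo_subset_Icc_self hxℓ)]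

theorem isCompactOperator_volterraInto (hℓ : 0 ≤ ℓ) (μ : Measure ℝ) [IsFiniteMeasure μ] :
    IsCompactOperator (volterraInto hℓ μ) :=
  (isCompactOperator_volterraCont hℓ).clm_comp (contToL2 hℓ μ)

theorem HasACDeriv.volterraInto_ae_eq {f g : ℝ → ℂ} {u : IntervalL2 ℓ} (h : HasACDeriv ℓ f g)
    (hf : f 0 = 0) (hu : u =ᵐ[intervalMeasure ℓ] g) (hℓ : 0 ≤ ℓ) {μ : Measure ℝ}
    [IsFiniteMeasure μ] (hμ : μ ≪ intervalMeasure ℓ) : volterraInto hℓ μ u =ᵐ[μ] f := by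
  filter_upwards [coeFn_volterraInto hℓ hμ u, hμ.ae_le (ae_restrict_mem measurableSet_Ioo)]
    with x hx hxℓ
  have hx' := Set.Ioo_subset_Icc_self hxℓ
  rw [hx, intervalIntegral_congr_ae_Ioo hu hx', h.2 x hx', hf, zero_add]

/-- The Volterra operator `f ↦ ∫₀ˣ f` on `L²(0, ℓ)`. -/
def volterra (hℓ : 0 ≤ ℓ) : IntervalL2 ℓ →L[ℂ] IntervalL2 ℓ :=
  volterraInto hℓ (intervalMeasure ℓ)

theorem coeFn_volterra (hℓ : 0 ≤ ℓ) (f : IntervalL2 ℓ) :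
    volterra hℓ f =ᵐ[intervalMeasure ℓ] fun x => ∫ t in (0 : ℝ)..x, f t :=
  coeFn_volterraInto hℓ .rfl f

/-- The constant function `1` in `L²(0, ℓ)`. -/
def oneL2 (ℓ : ℝ) : IntervalL2 ℓ := Lp.const 2 (intervalMeasure ℓ) 1

theorem coeFn_oneL2 : oneL2 ℓ =ᵐ[intervalMeasure ℓ] fun _ => 1 := Lp.coeFn_const _ _ _

theorem coeFn_smul_oneL2_add_volterra (hℓ : 0 ≤ ℓ) (c : ℂ) (v : IntervalL2 ℓ) :
    (c • oneL2 ℓ + volterra hℓ v : IntervalL2 ℓ) =ᵐ[intervalMeasure ℓ]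
      fun x => c + ∫ t in (0 : ℝ)..x, v t := by
  filter_upwards [coeFn_volterra hℓ v, coeFn_oneL2 (ℓ := ℓ), Lp.coeFn_smul c (oneL2 ℓ),
    Lp.coeFn_add (c • oneL2 ℓ) (volterra hℓ v)] with x hv hone hsmul hadd
  rw [hadd, Pi.add_apply, hsmul, Pi.smul_apply, hone, hv, smul_eq_mul, mul_one]

theorem inner_oneL2_left (hℓ : 0 ≤ ℓ) (f : IntervalL2 ℓ) :
    inner ℂ (oneL2 ℓ) f = ∫ t in (0 : ℝ)..ℓ, f t := by
  rw [L2.inner_def, intervalIntegral.integral_of_le hℓ, integral_Ioc_eq_integral_Ioo]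
  refine integral_congr_ae ?_
  filter_upwards [coeFn_oneL2] with x hx
  simp [hx]

theorem HasACDeriv.inner_oneL2_eq {f g : ℝ → ℂ} {u : IntervalL2 ℓ} (h : HasACDeriv ℓ f g)
    (hu : u =ᵐ[intervalMeasure ℓ] g) (hℓ : 0 ≤ ℓ) : inner ℂ (oneL2 ℓ) u = f ℓ - f 0 := by
  have hmem : ℓ ∈ Set.Icc 0 ℓ := ⟨hℓ, le_rfl⟩
  rw [inner_oneL2_left hℓ, intervalIntegral_congr_ae_Ioo hu hmem, h.2 ℓ hmem, add_sub_cancel_left]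

theorem HasACDeriv.eq_smul_oneL2_add_volterra {f g : ℝ → ℂ} {u v : IntervalL2 ℓ}
    (h : HasACDeriv ℓ f g) (hu : u =ᵐ[intervalMeasure ℓ] f) (hv : v =ᵐ[intervalMeasure ℓ] g)
    (hℓ : 0 ≤ ℓ) : u = f 0 • oneL2 ℓ + volterra hℓ v := by
  refine Lp.ext ?_
  filter_upwards [hu, coeFn_smul_oneL2_add_volterra hℓ (f 0) v, ae_restrict_mem measurableSet_Ioo]
    with x hux hvx hx
  have hx' := Set.Ioo_subset_Icc_self hx
  rw [hux, hvx, intervalIntegral_congr_ae_Ioo hv hx', h.2 x hx']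

theorem inner_volterra_add (hℓ : 0 ≤ ℓ) (f g : IntervalL2 ℓ) :
    inner ℂ f (volterra hℓ g) + inner ℂ (volterra hℓ f) g =
      inner ℂ f (oneL2 ℓ) * inner ℂ (oneL2 ℓ) g := by
  have hparts := ((f.hasACDeriv_integral.clm_comp (Complex.conjCLE : ℂ →L[ℝ] ℂ)).mul
    g.hasACDeriv_integral).2 ℓ ⟨hℓ, le_rfl⟩
  simp only [ContinuousLinearEquiv.coe_coe, Complex.conjCLE_apply, intervalIntegral.integral_same,
    mul_zero, zero_add] at hparts
  rw [← inner_conj_symm f (oneL2 ℓ), inner_oneL2_left hℓ, inner_oneL2_left hℓ, hparts,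
    intervalIntegral.integral_of_le hℓ, integral_Ioc_eq_integral_Ioo, L2.inner_def, L2.inner_def,
    ← integral_add (L2.integrable_inner _ _) (L2.integrable_inner _ _)]
  refine integral_congr_ae ?_
  filter_upwards [coeFn_volterra hℓ f, coeFn_volterra hℓ g] with x hf hg
  simp only [hf, hg, RCLike.inner_apply]
  ring

theorem inner_volterra_left_of_inner_oneL2_eq_zero (hℓ : 0 ≤ ℓ) {f : IntervalL2 ℓ}
    (hf : inner ℂ (oneL2 ℓ) f = 0) (g : IntervalL2 ℓ) :
    inner ℂ (volterra hℓ f) g = -inner ℂ f (volterra hℓ g) := by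
  rw [eq_neg_iff_add_eq_zero, add_comm, inner_volterra_add, inner_eq_zero_symm.1 hf, zero_mul]

end Volterra

/-! ### Coercive variational problems -/

section Variational

variable {𝕜 L H : Type*} [RCLike 𝕜] [NormedAddCommGroup L] [InnerProductSpace 𝕜 L]
  [CompleteSpace L] [NormedAddCommGroup H] [InnerProductSpace 𝕜 H] [CompleteSpace H]

theorem exists_isPositive_inverse_of_coercive (S : L →L[𝕜] L) (hS : S.IsSymmetric) {c : ℝ}
    (hc : 0 < c) (hSc : ∀ w, c * ‖w‖ ^ 2 ≤ RCLike.re (inner 𝕜 w (S w))) :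
    ∃ T : L →L[𝕜] L, T.IsPositive ∧ ∀ x y, S x = y ↔ x = T y := by
  have hunit : IsUnit S := by
    refine ContinuousLinearMap.isUnit_of_forall_le_norm_inner_map S (c := ⟨c, hc.le⟩) hc fun x => ?_
    rw [← inner_conj_symm, RCLike.norm_conj]
    exact (mul_comm _ _).trans_le ((hSc x).trans (RCLike.re_le_norm _))
  obtain ⟨U, rfl⟩ := hunit
  have hUT : ∀ x, (U : L →L[𝕜] L) ((↑U⁻¹ : L →L[𝕜] L) x) = x := DFunLike.congr_fun U.mul_inv
  have hTU : ∀ x, (↑U⁻¹ : L →L[𝕜] L) ((U : L →L[𝕜] L) x) = x := DFunLike.congr_fun U.inv_mul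
  have hT : ∀ x y, inner 𝕜 ((↑U⁻¹ : L →L[𝕜] L) x) y = inner 𝕜 x ((↑U⁻¹ : L →L[𝕜] L) y) :=
    fun x y => by
      conv_lhs => rw [← hUT y]
      exact (hS _ _).symm.trans (congrArg (inner 𝕜 · _) (hUT x))
  refine ⟨↑U⁻¹, ⟨hT, fun x => ?_⟩, fun x y =>
    ⟨fun h => h ▸ (hTU x).symm, fun h => h ▸ hUT y⟩⟩
  have hx := hSc ((↑U⁻¹ : L →L[𝕜] L) x)
  rw [hUT, inner_re_symm] at hx
  rw [ContinuousLinearMap.reApplyInnerSelf_apply, inner_re_symm]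
  exact (by positivity : 0 ≤ c * ‖(↑U⁻¹ : L →L[𝕜] L) x‖ ^ 2).trans hx

theorem exists_isPositive_solution_operator (B : L →L[𝕜] L) (hB : B.IsSymmetric) {c : ℝ}
    (hc : 0 < c) (hBc : ∀ w, c * ‖w‖ ^ 2 ≤ RCLike.re (inner 𝕜 w (B w))) (V : Submodule 𝕜 L)
    [CompleteSpace V] (R : L →L[𝕜] H) (hR : IsCompactOperator R) :
    ∃ K : H →L[𝕜] H, IsCompactOperator K ∧ K.IsPositive ∧
      ∀ u f, u = K f ↔ ∃ w ∈ V, u = R w ∧ ∀ η ∈ V, inner 𝕜 η (B w) = inner 𝕜 (R η) f := by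
  let S : V →L[𝕜] V := (ContinuousLinearMap.adjoint V.subtypeL).comp (B.comp V.subtypeL)
  have hS : ∀ x y : V, inner 𝕜 x (S y) = inner 𝕜 (x : L) (B y) := fun x y =>
    ContinuousLinearMap.adjoint_inner_right V.subtypeL x (B y)
  have hSsymm : S.IsSymmetric := fun x y =>
    (ContinuousLinearMap.adjoint_inner_left V.subtypeL y (B x)).trans ((hB x y).trans (hS x y).symm)
  obtain ⟨T, hT, hST⟩ := exists_isPositive_inverse_of_coercive S hSsymm hc
    fun w => (hBc w).trans_eq (by rw [hS])
  let R' : V →L[𝕜] H := R.comp V.subtypeL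
  have hR' : ∀ (η : V) f, inner 𝕜 (R η) f = inner 𝕜 η (ContinuousLinearMap.adjoint R' f) :=
    fun η f => (ContinuousLinearMap.adjoint_inner_right R' η f).symm
  refine ⟨R'.comp (T.comp (ContinuousLinearMap.adjoint R')),
    (hR.comp_clm V.subtypeL).comp_clm _, hT.conj_adjoint R', fun u f => ?_⟩
  have hweak : ∀ w : V, (∀ η ∈ V, inner 𝕜 η (B w) = inner 𝕜 (R η) f) ↔
      w = T (ContinuousLinearMap.adjoint R' f) := fun w => by
    rw [← hST]
    constructor
    · exact fun h => ext_inner_left 𝕜 fun η => (hS η w).trans ((h η η.2).trans (hR' η f))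
    · exact fun h η hη => (hS ⟨η, hη⟩ w).symm.trans (h ▸ (hR' ⟨η, hη⟩ f).symm)
  constructor
  · rintro rfl
    exact ⟨_, (T (ContinuousLinearMap.adjoint R' f)).2, rfl, (hweak _).2 rfl⟩
  · rintro ⟨w, hw, rfl, h⟩
    exact congrArg (fun x : V => R x) ((hweak ⟨w, hw⟩).1 h)

end Variational

/-! ### The energy form of the clamped beam -/

section Energy

variable {ℓ : ℝ} {σ q : ℝ → ℝ}

/-- The second derivatives of the functions in `H²₀(0, ℓ)`: the orthogonal complement of the affine
functions. -/
def clampedSpace (hℓ : 0 ≤ ℓ) : Submodule ℂ (IntervalL2 ℓ) :=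
  (Submodule.span ℂ {oneL2 ℓ, volterra hℓ (oneL2 ℓ)})ᗮ

instance (hℓ : 0 ≤ ℓ) : CompleteSpace (clampedSpace hℓ) :=
  (Submodule.isClosed_orthogonal _).completeSpace_coe

theorem mem_clampedSpace_iff (hℓ : 0 ≤ ℓ) (w : IntervalL2 ℓ) :
    w ∈ clampedSpace hℓ ↔ inner ℂ (oneL2 ℓ) w = 0 ∧ inner ℂ (oneL2 ℓ) (volterra hℓ w) = 0 := by
  have horth : w ∈ clampedSpace hℓ ↔
      inner ℂ (oneL2 ℓ) w = 0 ∧ inner ℂ (volterra hℓ (oneL2 ℓ)) w = 0 := by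
    simp only [clampedSpace, Submodule.mem_orthogonal, Submodule.mem_span_pair]
    constructor
    · intro h
      exact ⟨h _ ⟨1, 0, by simp⟩, h _ ⟨0, 1, by simp⟩⟩
    · rintro ⟨h₀, h₁⟩ _ ⟨a, b, rfl⟩
      rw [inner_add_left, inner_smul_left, inner_smul_left, h₀, h₁, mul_zero, mul_zero, add_zero]
  have hparts := inner_volterra_add hℓ (oneL2 ℓ) w
  rw [horth, and_congr_right_iff]
  intro h₀
  rw [h₀, mul_zero] at hparts
  rw [eq_neg_of_add_eq_zero_left hparts, neg_eq_zero]

/-- The equation `⟪η, u⟫ + ⟪J η, v⟫ = ⟪J² η, F⟫` says `u'' - v' = F` weakly; two integrations by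
parts turn it into the orthogonality of `u - J v - J² F` to `clampedSpace`. -/
theorem forall_clampedSpace_weak_iff (hℓ : 0 ≤ ℓ) (u v F : IntervalL2 ℓ) :
    (∀ η ∈ clampedSpace hℓ, inner ℂ η u + inner ℂ (volterra hℓ η) v =
        inner ℂ (volterra hℓ (volterra hℓ η)) F) ↔
      ∃ a b : ℂ, u = a • oneL2 ℓ + volterra hℓ (b • oneL2 ℓ + v + volterra hℓ F) := by
  let J := volterra hℓ
  have hparts : ∀ η ∈ clampedSpace hℓ, (inner ℂ η u + inner ℂ (J η) v = inner ℂ (J (J η)) F ↔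
      inner ℂ η (u - J v - J (J F)) = 0) := fun η hη => by
    obtain ⟨h₀, h₁⟩ := (mem_clampedSpace_iff hℓ η).1 hη
    rw [inner_volterra_left_of_inner_oneL2_eq_zero hℓ h₀,
      inner_volterra_left_of_inner_oneL2_eq_zero hℓ h₁,
      inner_volterra_left_of_inner_oneL2_eq_zero hℓ h₀, neg_neg, ← sub_eq_add_neg,
      inner_sub_right, inner_sub_right, sub_eq_zero]
  have : FiniteDimensional ℂ (Submodule.span ℂ {oneL2 ℓ, J (oneL2 ℓ)}) :=
    .span_of_finite ℂ (Set.toFinite _)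
  rw [forall₂_congr hparts, ← Submodule.mem_orthogonal, clampedSpace,
    Submodule.orthogonal_orthogonal, Submodule.mem_span_pair]
  refine exists₂_congr fun a b => ?_
  simp only [map_add, map_smul, J]
  rw [sub_sub, eq_sub_iff_add_eq, eq_comm]
  simp only [add_assoc]

/-- The operator of the form `∫ σ w η̄ + ∫ q (J w) (J η)⁻`, where `J` is the Volterra operator. -/
def energyOp (hℓ : 0 ≤ ℓ) (hσ : MemLp σ ⊤ (intervalMeasure ℓ))
    (hq : MemLp q ⊤ (intervalMeasure ℓ)) : IntervalL2 ℓ →L[ℂ] IntervalL2 ℓ :=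
  mulL2 hσ + (ContinuousLinearMap.adjoint (volterra hℓ)).comp ((mulL2 hq).comp (volterra hℓ))

variable (hℓ : 0 ≤ ℓ) (hσ : MemLp σ ⊤ (intervalMeasure ℓ)) (hq : MemLp q ⊤ (intervalMeasure ℓ))

theorem inner_energyOp_right (η w : IntervalL2 ℓ) : inner ℂ η (energyOp hℓ hσ hq w) =
    inner ℂ η (mulL2 hσ w) + inner ℂ (volterra hℓ η) (mulL2 hq (volterra hℓ w)) := by
  rw [← ContinuousLinearMap.adjoint_inner_right, ← inner_add_right]
  rfl

theorem isSymmetric_energyOp : (energyOp hℓ hσ hq).IsSymmetric := fun f g => by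
  change inner ℂ (energyOp hℓ hσ hq f) g = inner ℂ f (energyOp hℓ hσ hq g)
  rw [← inner_conj_symm, inner_energyOp_right, inner_energyOp_right, map_add, inner_conj_symm,
    inner_conj_symm]
  exact congrArg₂ (· + ·) (isSymmetric_mulL2 hσ f g) (isSymmetric_mulL2 hq _ _)

theorem le_re_inner_energyOp {c : ℝ} (hc : ∀ᵐ x ∂intervalMeasure ℓ, c ≤ σ x)
    (hq₀ : ∀ᵐ x ∂intervalMeasure ℓ, 0 ≤ q x) (w : IntervalL2 ℓ) :
    c * ‖w‖ ^ 2 ≤ (inner ℂ w (energyOp hℓ hσ hq w)).re := by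
  rw [inner_energyOp_right, Complex.add_re]
  have hqw := le_re_inner_mulL2 hq hq₀ (volterra hℓ w)
  rw [zero_mul] at hqw
  exact (le_re_inner_mulL2 hσ hc w).trans (le_add_of_nonneg_right hqw)

end Energy

/-! ### The weighted space and the clamped operator -/

section Weight

variable {ℓ : ℝ} {ρ : ℝ → ℝ}

theorem isFiniteMeasure_weightMeasure (hρ : MemLp ρ ⊤ (intervalMeasure ℓ)) :
    IsFiniteMeasure (weightMeasure ℓ ρ) :=
  isFiniteMeasure_withDensity_ofReal (hρ.integrable le_top).2

theorem weightMeasure_absolutelyContinuous : weightMeasure ℓ ρ ≪ intervalMeasure ℓ :=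
  withDensity_absolutelyContinuous _ _

theorem absolutelyContinuous_weightMeasure (hρ : AEMeasurable ρ (intervalMeasure ℓ))
    (hpos : ∀ᵐ x ∂intervalMeasure ℓ, 0 < ρ x) :
    intervalMeasure ℓ ≪ weightMeasure ℓ ρ := by
  refine withDensity_absolutelyContinuous' hρ.ennreal_ofReal ?_
  filter_upwards [hpos] with x hx
  exact (ENNReal.ofReal_pos.2 hx).ne'

theorem memLp_weight_mul (hρ : MemLp ρ ⊤ (intervalMeasure ℓ))
    (hpos : ∀ᵐ x ∂intervalMeasure ℓ, 0 < ρ x) (f : WeightedL2 ℓ ρ) :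
    MemLp (fun x => (ρ x : ℂ) * f x) 2 (intervalMeasure ℓ) := by
  have hf : AEStronglyMeasurable f (intervalMeasure ℓ) :=
    (Lp.aestronglyMeasurable f).mono_ac (absolutelyContinuous_weightMeasure hρ.1.aemeasurable hpos)
  have hsq : Integrable (fun x => ρ x * ‖f x‖ ^ 2) (intervalMeasure ℓ) := by
    have h := (memLp_two_iff_integrable_sq_norm (Lp.aestronglyMeasurable f)).1 (Lp.memLp f)
    change Integrable _ ((intervalMeasure ℓ).withDensity _) at h
    rw [integrable_withDensity_iff_integrable_smul₀'
      hρ.1.aemeasurable.ennreal_ofReal (.of_forall fun _ => ENNReal.ofReal_lt_top)] at h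
    refine h.congr ?_
    filter_upwards [hpos] with x hx
    rw [ENNReal.toReal_ofReal hx.le, smul_eq_mul]
  refine (memLp_two_iff_integrable_sq_norm
    ((Complex.continuous_ofReal.comp_aestronglyMeasurable hρ.1).mul hf)).2 ?_
  refine (hsq.mul_of_top_right hρ).congr (.of_forall fun x => ?_)
  simp only [Pi.mul_apply, norm_mul, Complex.norm_real, Real.norm_eq_abs, mul_pow, sq_abs]
  ring

variable (hρ : MemLp ρ ⊤ (intervalMeasure ℓ)) (hpos : ∀ᵐ x ∂intervalMeasure ℓ, 0 < ρ x)

/-- The function `ρ f ∈ L²(0, ℓ)` for `f ∈ L²_ρ(0, ℓ)`. -/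
def weightMul (f : WeightedL2 ℓ ρ) : IntervalL2 ℓ := (memLp_weight_mul hρ hpos f).toLp

theorem coeFn_weightMul (f : WeightedL2 ℓ ρ) :
    weightMul hρ hpos f =ᵐ[intervalMeasure ℓ] fun x => (ρ x : ℂ) * f x :=
  MemLp.coeFn_toLp _

theorem weightMul_ae_eq_iff {f : WeightedL2 ℓ ρ} {g : ℝ → ℂ} :
    weightMul hρ hpos f =ᵐ[intervalMeasure ℓ] g ↔
      f =ᵐ[weightMeasure ℓ ρ] fun x => (ρ x : ℂ)⁻¹ * g x := by
  constructor
  · intro h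
    filter_upwards [weightMeasure_absolutelyContinuous.ae_le h,
      weightMeasure_absolutelyContinuous.ae_le (coeFn_weightMul hρ hpos f),
      weightMeasure_absolutelyContinuous.ae_le hpos] with x hg hf hx
    rw [← hg, hf, inv_mul_cancel_left₀ (Complex.ofReal_ne_zero.2 hx.ne')]
  · intro h
    filter_upwards [(absolutelyContinuous_weightMeasure hρ.1.aemeasurable hpos).ae_le h,
      coeFn_weightMul hρ hpos f, hpos] with x hg hf hx
    rw [hf, hg, mul_inv_cancel_left₀ (Complex.ofReal_ne_zero.2 hx.ne')]

theorem inner_weightedL2 (f g : WeightedL2 ℓ ρ) : inner ℂ f g =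
    ∫ x, inner ℂ (f x) (weightMul hρ hpos g x) ∂intervalMeasure ℓ := by
  rw [L2.inner_def]
  change ∫ x, _ ∂((intervalMeasure ℓ).withDensity _) = _
  rw [integral_withDensity_eq_integral_toReal_smul₀ hρ.1.aemeasurable.ennreal_ofReal
    (.of_forall fun _ => ENNReal.ofReal_lt_top)]
  refine integral_congr_ae ?_
  filter_upwards [hpos, coeFn_weightMul hρ hpos g] with x hx hgx
  rw [hgx, ENNReal.toReal_ofReal hx.le, ← smul_eq_mul, inner_smul_right, Complex.real_smul]

/-- The operator `w ↦ ∫₀ˣ ∫₀ˢ w` from `L²(0, ℓ)` to `L²_ρ(0, ℓ)`. -/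
def weightedVolterraSq (hℓ : 0 ≤ ℓ) : IntervalL2 ℓ →L[ℂ] WeightedL2 ℓ ρ :=
  haveI := isFiniteMeasure_weightMeasure hρ
  (volterraInto hℓ (weightMeasure ℓ ρ)).comp (volterra hℓ)

theorem isCompactOperator_weightedVolterraSq (hℓ : 0 ≤ ℓ) :
    IsCompactOperator (weightedVolterraSq hρ hℓ) :=
  have := isFiniteMeasure_weightMeasure hρ
  (isCompactOperator_volterraInto hℓ (weightMeasure ℓ ρ)).comp_clm (volterra hℓ)

theorem weightedVolterraSq_ae_eq {f f' : ℝ → ℂ} {w : IntervalL2 ℓ} (hℓ : 0 ≤ ℓ)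
    (h : HasACDeriv ℓ f f') (hf : f 0 = 0) (hw : volterra hℓ w =ᵐ[intervalMeasure ℓ] f') :
    weightedVolterraSq hρ hℓ w =ᵐ[weightMeasure ℓ ρ] f :=
  have := isFiniteMeasure_weightMeasure hρ
  h.volterraInto_ae_eq hf hw hℓ weightMeasure_absolutelyContinuous

theorem weightedVolterraSq_ae_eq_volterra (hpos : ∀ᵐ x ∂intervalMeasure ℓ, 0 < ρ x)
    (hℓ : 0 ≤ ℓ) (w : IntervalL2 ℓ) :
    weightedVolterraSq hρ hℓ w =ᵐ[intervalMeasure ℓ] volterra hℓ (volterra hℓ w) := by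
  have h := weightedVolterraSq_ae_eq hρ hℓ (volterra hℓ w).hasACDeriv_integral
    intervalIntegral.integral_same .rfl
  filter_upwards [(absolutelyContinuous_weightMeasure hρ.1.aemeasurable hpos).ae_le h,
    coeFn_volterra hℓ (volterra hℓ w)] with x hx hx'
  exact hx.trans hx'.symm

theorem inner_weightedVolterraSq (hℓ : 0 ≤ ℓ) (w : IntervalL2 ℓ) (f : WeightedL2 ℓ ρ) :
    inner ℂ (weightedVolterraSq hρ hℓ w) f =
      inner ℂ (volterra hℓ (volterra hℓ w)) (weightMul hρ hpos f) := by
  rw [inner_weightedL2 hρ hpos, L2.inner_def]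
  refine integral_congr_ae ?_
  filter_upwards [weightedVolterraSq_ae_eq_volterra hρ hpos hℓ w] with x hx
  rw [hx]

theorem smul_oneL2_add_volterra_eq_zero (hℓ : 0 < ℓ) {c : ℂ} {v : IntervalL2 ℓ}
    (h : c • oneL2 ℓ + volterra hℓ.le v = 0) : v = 0 := by
  have hderiv := hasACDeriv_integral c v.integrableOn
  have hae : (fun x => c + ∫ t in (0 : ℝ)..x, v t) =ᵐ[intervalMeasure ℓ] 0 :=
    (coeFn_smul_oneL2_add_volterra hℓ.le c v).symm.trans (h ▸ Lp.coeFn_zero ℂ 2 _)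
  exact Lp.eq_zero_iff_ae_eq_zero.2
    (hderiv.ae_eq_zero (eqOn_zero_of_ae_eq_zero hderiv.continuousOn hℓ hae))

theorem volterra_injective (hℓ : 0 < ℓ) : Function.Injective (volterra hℓ.le) :=
  (injective_iff_map_eq_zero _).2 fun v hv =>
    smul_oneL2_add_volterra_eq_zero hℓ (c := 0) (by rw [zero_smul, zero_add, hv])

theorem weightedVolterraSq_injective (hpos : ∀ᵐ x ∂intervalMeasure ℓ, 0 < ρ x) (hℓ : 0 < ℓ) :
    Function.Injective (weightedVolterraSq hρ hℓ.le) := by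
  refine (injective_iff_map_eq_zero _).2 fun w hw => ?_
  have hJJw : volterra hℓ.le (volterra hℓ.le w) = 0 := Lp.eq_zero_iff_ae_eq_zero.2
    ((weightedVolterraSq_ae_eq_volterra hρ hpos hℓ.le w).symm.trans
      ((absolutelyContinuous_weightMeasure hρ.1.aemeasurable hpos).ae_le
        (Lp.eq_zero_iff_ae_eq_zero.1 hw)))
  exact volterra_injective hℓ (volterra_injective hℓ (by rw [hJJw, map_zero, map_zero]))

end Weight

section ClampedGraph

variable {ℓ : ℝ} {ρ σ q : ℝ → ℝ}

/-- `σ w = a + J (b + q J w + J F)` is the equation `(σ w)'' - (q J w)' = F` integrated twice. -/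
theorem exists_integratedEquation_of_jets (hℓ : 0 ≤ ℓ) (hσ : MemLp σ ⊤ (intervalMeasure ℓ))
    (hq : MemLp q ⊤ (intervalMeasure ℓ)) {w F : IntervalL2 ℓ} {W Q : ℕ → ℝ → ℂ}
    (hW : IsSobolevJet ℓ 2 W) (hW₀ : W 0 =ᵐ[intervalMeasure ℓ] fun x => (σ x : ℂ) * w x)
    (hQ : IsSobolevJet ℓ 1 Q)
    (hQ₀ : Q 0 =ᵐ[intervalMeasure ℓ] fun x => (q x : ℂ) * volterra hℓ w x)
    (hF : F =ᵐ[intervalMeasure ℓ] W 2 - Q 1) :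
    ∃ a b : ℂ, mulL2 hσ w =
      a • oneL2 ℓ + volterra hℓ (b • oneL2 ℓ + mulL2 hq (volterra hℓ w) + volterra hℓ F) := by
  have hW₁ := (hW.2 1 one_le_two).coeFn_toLp
  have hW₂ := (hW.2 2 le_rfl).coeFn_toLp
  have hQ₁ := (hQ.2 1 le_rfl).coeFn_toLp
  have hσw := (hW.1 0 two_pos).eq_smul_oneL2_add_volterra
    ((coeFn_mulL2 hσ w).trans hW₀.symm) hW₁ hℓ
  have hσw' := (hW.1 1 one_lt_two).eq_smul_oneL2_add_volterra hW₁ hW₂ hℓ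
  have hqw := (hQ.1 0 one_pos).eq_smul_oneL2_add_volterra
    ((coeFn_mulL2 hq (volterra hℓ w)).trans hQ₀.symm) hQ₁ hℓ
  have hFsub : F = (hW.2 2 le_rfl).toLp - (hQ.2 1 le_rfl).toLp := by
    rw [← MemLp.toLp_sub]
    exact Lp.ext (hF.trans (MemLp.coeFn_toLp _).symm)
  refine ⟨W 0 0, W 1 0 - Q 0 0, hσw.trans ?_⟩
  rw [hσw', hqw, hFsub, map_sub, sub_smul]
  congr 2
  abel

theorem MemSobolev.exists_ofReal_mul_eqOn {k : ℕ} {s : ℝ → ℂ} (hs : MemSobolev ℓ (k + 1) s)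
    (hσ : MemSobolev ℓ (k + 1) σ) (hσ₀ : ∀ x ∈ Set.Icc 0 ℓ, σ x ≠ 0) :
    ∃ d : ℝ → ℂ, MemSobolev ℓ (k + 1) d ∧
      Set.EqOn (fun x => (σ x : ℂ) * d x) s (Set.Icc 0 ℓ) := by
  refine ⟨_, ((hσ.inv hσ₀).clm_comp Complex.ofRealCLM).mul hs, fun x hx => ?_⟩
  simp only [Complex.ofRealCLM_apply, Complex.ofReal_inv]
  exact mul_inv_cancel_left₀ (Complex.ofReal_ne_zero.2 (hσ₀ x hx)) _

theorem exists_jets_of_integratedEquation (hℓ : 0 ≤ ℓ) (hσ : MemSobolev ℓ 2 σ)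
    (hσ₀ : ∀ x ∈ Set.Icc 0 ℓ, σ x ≠ 0) (hq : MemSobolev ℓ 1 q)
    (hσ' : MemLp σ ⊤ (intervalMeasure ℓ)) (hq' : MemLp q ⊤ (intervalMeasure ℓ))
    {w F : IntervalL2 ℓ} {a b : ℂ} (h : mulL2 hσ' w =
      a • oneL2 ℓ + volterra hℓ (b • oneL2 ℓ + mulL2 hq' (volterra hℓ w) + volterra hℓ F)) :
    ∃ D W Q : ℕ → ℝ → ℂ, (IsSobolevJet ℓ 2 D ∧ D 0 =ᵐ[intervalMeasure ℓ] w) ∧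
      (IsSobolevJet ℓ 2 W ∧ ∀ x, W 0 x = (σ x : ℂ) * D 0 x) ∧
      (IsSobolevJet ℓ 1 Q ∧ ∀ x, Q 0 x = (q x : ℂ) * ∫ t in (0 : ℝ)..x, w t) ∧
      F =ᵐ[intervalMeasure ℓ] W 2 - Q 1 := by
  have hJw : MemSobolev ℓ 1 fun x => ∫ t in (0 : ℝ)..x, w t :=
    memSobolev_one_iff.2 ⟨w, w.hasACDeriv_integral, Lp.memLp w⟩
  obtain ⟨Q, hQ₀, hQ⟩ := (hq.clm_comp Complex.ofRealCLM).mul hJw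
  let S₁ : ℝ → ℂ := fun x => b + (Q 0 x + ∫ t in (0 : ℝ)..x, F t)
  have hS₁ : HasACDeriv ℓ S₁ (Q 1 + F) :=
    ((hQ.1 0 one_pos).add F.hasACDeriv_integral).const_add b
  have hS₂ : MemLp (Q 1 + (F : ℝ → ℂ)) 2 (intervalMeasure ℓ) := (hQ.2 1 le_rfl).add (Lp.memLp F)
  let S₀ : ℝ → ℂ := fun x => a + ∫ t in (0 : ℝ)..x, S₁ t
  have hS₀ : HasACDeriv ℓ S₀ S₁ := hasACDeriv_integral a
    (integrableOn_of_memLp_two (memLp_of_continuousOn hS₁.continuousOn 2))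
  obtain ⟨_, ⟨D, rfl, hD⟩, hσD⟩ := (memSobolev_succ_iff.2
    ⟨_, hS₀, memSobolev_one_iff.2 ⟨_, hS₁, hS₂⟩⟩).exists_ofReal_mul_eqOn hσ hσ₀
  have hv : (b • oneL2 ℓ + mulL2 hq' (volterra hℓ w) + volterra hℓ F : IntervalL2 ℓ)
      =ᵐ[intervalMeasure ℓ] S₁ := by
    rw [add_right_comm]
    filter_upwards [coeFn_smul_oneL2_add_volterra hℓ b F, coeFn_mulL2 hq' (volterra hℓ w),
      coeFn_volterra hℓ w, Lp.coeFn_add (b • oneL2 ℓ + volterra hℓ F) (mulL2 hq' (volterra hℓ w))]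
      with x h₁ h₂ h₃ h₄
    simp only [S₁, hQ₀, h₄, Pi.add_apply, h₁, h₂, h₃, Complex.ofRealCLM_apply]
    ring
  have hw : D 0 =ᵐ[intervalMeasure ℓ] w := by
    filter_upwards [coeFn_mulL2 hσ' w, coeFn_smul_oneL2_add_volterra hℓ a _,
      ae_restrict_mem measurableSet_Ioo] with x h₁ h₂ hx
    have hx' := Set.Ioo_subset_Icc_self hx
    refine mul_left_cancel₀ (Complex.ofReal_ne_zero.2 (hσ₀ x hx')) ?_
    rw [← h₁, h, h₂, intervalIntegral_congr_ae_Ioo hv hx']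
    exact hσD hx'
  exact ⟨D, consJet (fun x => (σ x : ℂ) * D 0 x) (consJet S₁ fun _ => Q 1 + F), Q, ⟨hD, hw⟩,
    ⟨.cons (hS₀.congr hσD .rfl) (.cons hS₁ ⟨by simp, fun _ _ => hS₂⟩), fun _ => rfl⟩,
    ⟨hQ, fun x => congrFun hQ₀ x⟩, .of_eq (add_sub_cancel_left (Q 1) (F : ℝ → ℂ)).symm⟩

theorem mem_clampedGraph_iff (hℓ : 0 ≤ ℓ) (hρ : MemLp ρ ⊤ (intervalMeasure ℓ))
    (hpos : ∀ᵐ x ∂intervalMeasure ℓ, 0 < ρ x) (hσ : MemSobolev ℓ 2 σ)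
    (hσ₀ : ∀ x ∈ Set.Icc 0 ℓ, σ x ≠ 0) (hq : MemSobolev ℓ 1 q)
    (hσ' : MemLp σ ⊤ (intervalMeasure ℓ)) (hq' : MemLp q ⊤ (intervalMeasure ℓ))
    {p : WeightedL2 ℓ ρ × WeightedL2 ℓ ρ} :
    p ∈ clampedGraph ℓ ρ σ q ↔ ∃ w ∈ clampedSpace hℓ, p.1 = weightedVolterraSq hρ hℓ w ∧
      ∃ a b : ℂ, mulL2 hσ' w = a • oneL2 ℓ + volterra hℓ
        (b • oneL2 ℓ + mulL2 hq' (volterra hℓ w) + volterra hℓ (weightMul hρ hpos p.2)) := by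
  constructor
  · rintro ⟨Y, W, Q, hY, ⟨hY₀, hY₀', hYℓ, hYℓ'⟩, ⟨hW, hW₀⟩, ⟨hQ, hQ₀⟩, h₁, h₂⟩
    have hY₂ : MemLp (Y 2) 2 (intervalMeasure ℓ) := hY.2 2 (by norm_num)
    have hJw : volterra hℓ hY₂.toLp =ᵐ[intervalMeasure ℓ] Y 1 :=
      (hY.1 1 (by norm_num)).volterraInto_ae_eq hY₀' hY₂.coeFn_toLp hℓ .rfl
    refine ⟨hY₂.toLp, (mem_clampedSpace_iff hℓ _).2 ⟨?_, ?_⟩, ?_, ?_⟩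
    · rw [(hY.1 1 (by norm_num)).inner_oneL2_eq hY₂.coeFn_toLp hℓ, hYℓ', hY₀', sub_zero]
    · rw [(hY.1 0 (by norm_num)).inner_oneL2_eq hJw hℓ, hYℓ, hY₀, sub_zero]
    · exact Lp.ext (h₁.trans
        (weightedVolterraSq_ae_eq hρ hℓ (hY.1 0 (by norm_num)) hY₀ hJw).symm)
    · refine exists_integratedEquation_of_jets hℓ hσ' hq' hW ?_ hQ ?_
        ((weightMul_ae_eq_iff hρ hpos).2 h₂)
      · filter_upwards [hY₂.coeFn_toLp] with x hx
        rw [hW₀, hx]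
      · filter_upwards [hJw] with x hx
        rw [hQ₀, hx]
  · rintro ⟨w, hw, hp₁, a, b, hp₂⟩
    obtain ⟨D, W, Q, ⟨hD, hDw⟩, hW, hQ, hF⟩ :=
      exists_jets_of_integratedEquation hℓ hσ hσ₀ hq hσ' hq' hp₂
    obtain ⟨hw₀, hw₁⟩ := (mem_clampedSpace_iff hℓ w).1 hw
    rw [inner_oneL2_left hℓ] at hw₀ hw₁
    have hY₁ : HasACDeriv ℓ (fun x => ∫ t in (0 : ℝ)..x, w t) (D 0) :=
      w.hasACDeriv_integral.congr (Set.eqOn_refl _ _) hDw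
    have hY₀ : HasACDeriv ℓ (fun x => ∫ t in (0 : ℝ)..x, volterra hℓ w t)
        (fun x => ∫ t in (0 : ℝ)..x, w t) :=
      (volterra hℓ w).hasACDeriv_integral.congr (Set.eqOn_refl _ _) (coeFn_volterra hℓ w).symm
    exact ⟨consJet _ (consJet _ D), W, Q, .cons hY₀ (.cons hY₁ hD),
      ⟨intervalIntegral.integral_same, intervalIntegral.integral_same, hw₁, hw₀⟩, hW, hQ,
      hp₁ ▸ weightedVolterraSq_ae_eq hρ hℓ hY₀ intervalIntegral.integral_same
        (coeFn_volterra hℓ w), (weightMul_ae_eq_iff hρ hpos).1 hF⟩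

theorem eq_zero_of_zero_mem_clampedGraph (hℓ : 0 < ℓ) (hρ : MemLp ρ ⊤ (intervalMeasure ℓ))
    (hpos : ∀ᵐ x ∂intervalMeasure ℓ, 0 < ρ x) (hσ : MemSobolev ℓ 2 σ)
    (hσ₀ : ∀ x ∈ Set.Icc 0 ℓ, σ x ≠ 0) (hq : MemSobolev ℓ 1 q) {f : WeightedL2 ℓ ρ}
    (h : (0, f) ∈ clampedGraph ℓ ρ σ q) : f = 0 := by
  obtain ⟨w, -, hRw, a, b, hw⟩ := (mem_clampedGraph_iff hℓ.le hρ hpos hσ hσ₀ hq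
    (memLp_of_continuousOn hσ.continuousOn ⊤) (memLp_of_continuousOn hq.continuousOn ⊤)).1 h
  have hw₀ : w = 0 :=
    weightedVolterraSq_injective hρ hpos hℓ (hRw.symm.trans (map_zero _).symm)
  rw [hw₀, map_zero, map_zero, map_zero, add_zero] at hw
  have hF := smul_oneL2_add_volterra_eq_zero hℓ (smul_oneL2_add_volterra_eq_zero hℓ hw.symm)
  have hf := (weightMul_ae_eq_iff hρ hpos).1 (hF ▸ Lp.coeFn_zero ℂ 2 (intervalMeasure ℓ))
  refine Lp.eq_zero_iff_ae_eq_zero.2 (hf.trans (.of_eq ?_))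
  simp only [Pi.zero_apply, mul_zero]
  rfl

theorem exists_isPositive_clampedSolution (hℓ : 0 ≤ ℓ) (hρ : MemLp ρ ⊤ (intervalMeasure ℓ))
    (hpos : ∀ᵐ x ∂intervalMeasure ℓ, 0 < ρ x) (hσ : MemSobolev ℓ 2 σ) {c : ℝ} (hc : 0 < c)
    (hσ₀ : ∀ x ∈ Set.Icc 0 ℓ, c ≤ σ x) (hq : MemSobolev ℓ 1 q)
    (hq₀ : ∀ x ∈ Set.Icc 0 ℓ, 0 ≤ q x) :
    ∃ K : WeightedL2 ℓ ρ →L[ℂ] WeightedL2 ℓ ρ, IsCompactOperator K ∧ K.IsPositive ∧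
      ∀ u f, (u, f) ∈ clampedGraph ℓ ρ σ q ↔ u = K f := by
  have hσ' : MemLp σ ⊤ (intervalMeasure ℓ) := memLp_of_continuousOn hσ.continuousOn ⊤
  have hq' : MemLp q ⊤ (intervalMeasure ℓ) := memLp_of_continuousOn hq.continuousOn ⊤
  have hae {P : ℝ → Prop} (h : ∀ x ∈ Set.Icc 0 ℓ, P x) : ∀ᵐ x ∂intervalMeasure ℓ, P x :=
    ae_restrict_of_forall_mem measurableSet_Ioo fun x hx => h x (Set.Ioo_subset_Icc_self hx)
  obtain ⟨K, hK, hKpos, hKu⟩ := exists_isPositive_solution_operator (energyOp hℓ hσ' hq')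
    (isSymmetric_energyOp hℓ hσ' hq') hc (le_re_inner_energyOp hℓ hσ' hq' (hae hσ₀) (hae hq₀))
    (clampedSpace hℓ) (weightedVolterraSq hρ hℓ) (isCompactOperator_weightedVolterraSq hρ hℓ)
  refine ⟨K, hK, hKpos, fun u f => ?_⟩
  rw [mem_clampedGraph_iff hℓ hρ hpos hσ (fun x hx => (hc.trans_le (hσ₀ x hx)).ne') hq hσ' hq',
    hKu]
  simp only [inner_energyOp_right, inner_weightedVolterraSq hρ hpos,
    forall_clampedSpace_weak_iff]

end ClampedGraph

/-! ### Eigenbases of compact operators -/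

section Enumeration

theorem nonempty_orderIso_nat {ι : Type*} [LinearOrder ι] [Infinite ι]
    (h : ∀ i : ι, (Set.Iic i).Finite) : Nonempty (ℕ ≃o ι) := by
  let rank : ι → ℕ := fun i => (Set.Iio i).ncard
  have hrank : StrictMono rank := fun i j hij => Set.ncard_lt_ncard
    ((Set.ssubset_iff_of_subset (Set.Iio_subset_Iio hij.le)).2 ⟨i, hij, lt_irrefl i⟩)
    ((h j).subset Set.Iio_subset_Iic_self)
  have : Infinite (Set.range rank) := Set.infinite_range_of_injective hrank.injective |>.to_subtype
  have := Classical.decPred (· ∈ Set.range rank)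
  exact ⟨(Nat.Subtype.orderIsoOfNat (Set.range rank)).trans (hrank.orderIso rank).symm⟩

theorem exists_equiv_nat_monotone {ι α : Type*} [Infinite ι] [LinearOrder α] [NoMaxOrder α]
    {f : ι → α} (hf : Filter.Tendsto f Filter.cofinite Filter.atTop) :
    ∃ e : ℕ ≃ ι, Monotone (f ∘ e) := by
  let : LinearOrder ι := IsWellOrder.linearOrder WellOrderingRel
  let φ : ι → α ×ₗ ι := fun i => toLex (f i, i)
  have hφ : Function.Injective φ := fun i j h => congrArg (fun p => (ofLex p).2) h
  have hle : ∀ i j, φ i ≤ φ j → f i ≤ f j := fun i j h => Prod.Lex.monotone_fst _ _ h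
  let : LinearOrder ι := LinearOrder.lift' φ hφ
  have hmono : Monotone f := hle
  obtain ⟨e⟩ := nonempty_orderIso_nat fun i : ι =>
    (Filter.eventually_cofinite.1 (hf.eventually_gt_atTop (f i))).subset
      fun j hj => not_lt.2 (hmono hj)
  exact ⟨e.toEquiv, hmono.comp e.monotone⟩

end Enumeration

section CompactEigenbasis

variable {𝕜 H : Type*} [RCLike 𝕜] [NormedAddCommGroup H] [InnerProductSpace 𝕜 H] {K : H →L[𝕜] H}
  {ι : Type*}

theorem exists_pos_eigenvalue (hpos : K.IsPositive) (hinj : Function.Injective K) {v : H}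
    (hv : v ≠ 0) {μ : 𝕜} (h : K v = μ • v) : ∃ r : ℝ, 0 < r ∧ K v = (r : 𝕜) • v := by
  have hv' : ‖v‖ ^ 2 ≠ 0 := pow_ne_zero 2 (norm_ne_zero_iff.2 hv)
  obtain ⟨s, hs, hsv⟩ := RCLike.nonneg_iff_exists_ofReal.1 (hpos.inner_nonneg_right v)
  have hμ : μ = ((s / ‖v‖ ^ 2 : ℝ) : 𝕜) := by
    rw [RCLike.ofReal_div, hsv, h, inner_smul_right, inner_self_eq_norm_sq_to_K, RCLike.ofReal_pow,
      mul_div_cancel_right₀]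
    exact_mod_cast hv'
  refine ⟨s / ‖v‖ ^ 2, (div_nonneg hs (sq_nonneg _)).lt_of_ne fun h₀ => hv (hinj ?_), hμ ▸ h⟩
  rw [h, hμ, ← h₀, RCLike.ofReal_zero, zero_smul, map_zero]

theorem tendsto_eigenvalue_cofinite_zero (hK : IsCompactOperator K) {v : ι → H}
    (hv : Orthonormal 𝕜 v) {μ : ι → 𝕜} (hμ : ∀ i, K (v i) = μ i • v i) :
    Filter.Tendsto μ Filter.cofinite (nhds 0) := by
  have hsep : ∀ i j, i ≠ j → ‖μ i‖ ≤ dist (K (v i)) (K (v j)) := fun i j hij => by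
    have hinner : inner 𝕜 (v i) (K (v i) - K (v j)) = μ i := by
      rw [hμ, hμ, inner_sub_right, inner_smul_right, inner_smul_right, hv.2 hij,
        inner_self_eq_norm_sq_to_K, hv.1]
      simp
    rw [dist_eq_norm, ← hinner]
    simpa only [hv.1, one_mul] using norm_inner_le_norm (𝕜 := 𝕜) (v i) (K (v i) - K (v j))
  refine Metric.tendsto_nhds.2 fun ε hε => Filter.eventually_cofinite.2 ?_
  by_contra hinf
  let e := Set.Infinite.natEmbedding _ hinf
  have hmem : ∀ n, K (v (e n)) ∈ closure (K '' Metric.closedBall 0 1) := fun n =>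
    subset_closure ⟨v (e n), by simp [hv.1], rfl⟩
  obtain ⟨a, -, φ, hφ, hlim⟩ :=
    (hK.isCompact_closure_image_closedBall (𝕜₁ := 𝕜) 1).tendsto_subseq hmem
  obtain ⟨N, hN⟩ := Metric.cauchySeq_iff'.1 hlim.cauchySeq ε hε
  have hne : (e (φ (N + 1)) : ι) ≠ e (φ N) := fun h =>
    N.succ_ne_self (hφ.injective (e.injective (Subtype.ext h)))
  refine (e (φ (N + 1))).2 ((dist_zero_right _).trans_lt ?_)
  exact (hsep _ _ hne).trans_lt (hN (N + 1) N.le_succ)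

theorem infinite_of_hilbertBasis (b : HilbertBasis ι 𝕜 H) (hdim : ¬ FiniteDimensional 𝕜 H) :
    Infinite ι := by
  by_contra hι
  have := not_infinite_iff_finite.1 hι
  have := Fintype.ofFinite ι
  exact hdim b.toOrthonormalBasis.toBasis.finiteDimensional_of_finite

variable [CompleteSpace H]

theorem exists_hilbertBasis_of_orthogonal_iSup_eq_bot {E : ι → Submodule 𝕜 H}
    [∀ i, CompleteSpace (E i)] (hE : OrthogonalFamily 𝕜 (fun i => E i) fun i => (E i).subtypeₗᵢ)
    (h : (⨆ i, E i)ᗮ = ⊥) :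
    ∃ (w : ∀ i, Set (E i)) (b : HilbertBasis (Σ i, w i) 𝕜 H), ∀ p, b p ∈ E p.1 := by
  choose w b _ using fun i => exists_hilbertBasis 𝕜 (E i)
  let v : (Σ i, w i) → H := fun p => (b p.1 p.2 : E p.1)
  have hv : Orthonormal 𝕜 v := hE.orthonormal_sigma_orthonormal fun i => (b i).orthonormal
  have hspan : ⨆ i, E i ≤ (Submodule.span 𝕜 (Set.range v)).topologicalClosure := by
    refine iSup_le fun i x hx => ?_
    have hsum : HasSum (fun j => (b i).repr ⟨x, hx⟩ j • v ⟨i, j⟩) x :=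
      (E i).subtypeL.hasSum ((b i).hasSum_repr ⟨x, hx⟩)
    have hmem : ∀ j, v ⟨i, j⟩ ∈ Submodule.span 𝕜 (Set.range v) := fun j =>
      Submodule.subset_span ⟨⟨i, j⟩, rfl⟩
    exact mem_closure_of_tendsto hsum <| .of_forall fun s =>
      Submodule.sum_mem _ fun j _ => Submodule.smul_mem _ _ (hmem j)
  have hbot : (Submodule.span 𝕜 (Set.range v))ᗮ = ⊥ := by
    rw [← Submodule.orthogonal_closure, eq_bot_iff, ← h]
    exact Submodule.orthogonal_le hspan
  refine ⟨w, HilbertBasis.mkOfOrthogonalEqBot hv hbot, fun p => ?_⟩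
  rw [HilbertBasis.coe_mkOfOrthogonalEqBot]
  exact (b p.1 p.2 : E p.1).2

theorem exists_monotone_eigenbasis (hK : IsCompactOperator K) (hpos : K.IsPositive)
    (hinj : Function.Injective K) (hdim : ¬ FiniteDimensional 𝕜 H) :
    ∃ (lam : ℕ → ℝ) (Φ : HilbertBasis ℕ 𝕜 H), Monotone lam ∧ (∀ n, 0 < lam n) ∧
      Filter.Tendsto lam Filter.atTop Filter.atTop ∧ ∀ n, K ((lam n : 𝕜) • Φ n) = Φ n := by
  have hsymm := hpos.isSymmetric
  obtain ⟨w, b, hb⟩ := exists_hilbertBasis_of_orthogonal_iSup_eq_bot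
    hsymm.orthogonalFamily_eigenspaces
    (ContinuousLinearMap.orthogonalComplement_iSup_eigenspaces_eq_bot hK hsymm)
  have := infinite_of_hilbertBasis b hdim
  choose ν hν hKν using fun p => exists_pos_eigenvalue hpos hinj (b.orthonormal.ne_zero p)
    (Module.End.mem_eigenspace_iff.1 (hb p))
  have hν₀ : Filter.Tendsto ν Filter.cofinite (nhdsWithin 0 (Set.Ioi 0)) := by
    refine tendsto_nhdsWithin_iff.2 ⟨?_, .of_forall hν⟩
    have h := tendsto_eigenvalue_cofinite_zero hK b.orthonormal hKν
    simpa only [norm_zero, RCLike.norm_of_nonneg (hν _).le, Function.comp_def] using h.norm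
  obtain ⟨e, hmono⟩ := exists_equiv_nat_monotone (tendsto_inv_nhdsGT_zero.comp hν₀)
  have hspan : ⊤ ≤ (Submodule.span 𝕜 (Set.range (b ∘ e))).topologicalClosure := by
    rw [e.surjective.range_comp, b.dense_span]
  refine ⟨fun n => (ν (e n))⁻¹, .mk (b.orthonormal.comp e e.injective) hspan, hmono,
    fun n => inv_pos.2 (hν _), ?_, fun n => ?_⟩
  · rw [← Nat.cofinite_eq_atTop]
    exact (tendsto_inv_nhdsGT_zero.comp hν₀).comp e.injective.tendsto_cofinite
  · rw [HilbertBasis.coe_mk, map_smul, Function.comp_apply, hKν, smul_smul, RCLike.ofReal_inv,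
      inv_mul_cancel₀ (RCLike.ofReal_ne_zero.2 (hν _).ne'), one_smul]

end CompactEigenbasis

section InfiniteDimensional

theorem not_finiteDimensional_Lp_two {α 𝕜 : Type*} [MeasurableSpace α] [RCLike 𝕜] {μ : Measure α}
    {s : ℕ → Set α} (hs : ∀ n, MeasurableSet (s n)) (hdisj : Pairwise (Function.onFun Disjoint s))
    (hμ₀ : ∀ n, μ (s n) ≠ 0) (hμ : ∀ n, μ (s n) ≠ ⊤) : ¬ FiniteDimensional 𝕜 (Lp 𝕜 2 μ) := by
  intro hfin
  let v : ℕ → Lp 𝕜 2 μ := fun n => indicatorConstLp 2 (hs n) (hμ n) 1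
  have hinner : ∀ m n, inner 𝕜 (v m) (v n) = ((μ.real (s m ∩ s n) : ℝ) : 𝕜) := fun m n =>
    L2.inner_indicatorConstLp_one_indicatorConstLp_one (hs m) (hs n) (hμ m) (hμ n)
  have hli : LinearIndependent 𝕜 v := by
    refine linearIndependent_of_ne_zero_of_inner_eq_zero (fun n hn => ?_) fun m n hmn => ?_
    · have h := hinner n n
      rw [hn, inner_zero_left, Set.inter_self, eq_comm, RCLike.ofReal_eq_zero] at h
      exact hμ₀ n ((measureReal_eq_zero_iff (hμ n)).1 h)
    · change inner 𝕜 (v m) (v n) = 0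
      rw [hinner, (hdisj hmn).inter_eq, measureReal_empty, RCLike.ofReal_zero]
  have := hli.finite
  exact not_finite ℕ

theorem not_finiteDimensional_weightedL2 {ℓ : ℝ} {ρ : ℝ → ℝ} (hℓ : 0 < ℓ)
    (hρ : MemLp ρ ⊤ (intervalMeasure ℓ)) (hpos : ∀ᵐ x ∂intervalMeasure ℓ, 0 < ρ x) :
    ¬ FiniteDimensional ℂ (WeightedL2 ℓ ρ) := by
  have := isFiniteMeasure_weightMeasure hρ
  let u : ℕ → ℝ := fun n => ℓ / (n + 1)
  have hu : StrictAnti u := strictAnti_nat_of_succ_lt fun n => by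
    dsimp only [u]
    gcongr
    exact n.lt_succ_self
  refine not_finiteDimensional_Lp_two (s := fun n => Set.Ioo (u (Order.succ n)) (u n))
    (fun n => measurableSet_Ioo) hu.antitone.pairwise_disjoint_on_Ioo_succ (fun n h => ?_)
    fun n => measure_ne_top _ _
  have hsub : Set.Ioo (u (Order.succ n)) (u n) ⊆ Set.Ioo 0 ℓ :=
    Set.Ioo_subset_Ioo (by positivity) (div_le_self hℓ.le (by simp))
  have h' := absolutelyContinuous_weightMeasure hρ.1.aemeasurable hpos h
  rw [intervalMeasure, Measure.restrict_eq_self _ hsub, Real.volume_Ioo, ENNReal.ofReal_eq_zero,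
    sub_nonpos] at h'
  exact (hu (Order.lt_succ n)).not_ge h'

end InfiniteDimensional

/-! ### Coefficients in a Hilbert basis -/

section HilbertBasisCoefficients

variable {ι 𝕜 H : Type*} [RCLike 𝕜] [NormedAddCommGroup H] [InnerProductSpace 𝕜 H]
  (Φ : HilbertBasis ι 𝕜 H)

theorem hasSum_norm_sq_inner (x : H) : HasSum (fun i => ‖inner 𝕜 (Φ i) x‖ ^ 2) (‖x‖ ^ 2) := by
  have h := lp.hasSum_norm (p := 2) (by norm_num) (Φ.repr x)
  simpa only [ENNReal.toReal_ofNat, Real.rpow_two, Φ.repr_apply_apply,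
    LinearIsometryEquiv.norm_map] using h

theorem eq_of_forall_inner_eq {x y : H} (h : ∀ i, inner 𝕜 (Φ i) x = inner 𝕜 (Φ i) y) : x = y :=
  Φ.repr.injective (lp.ext (funext fun i => by rw [Φ.repr_apply_apply, Φ.repr_apply_apply, h]))

theorem norm_eq_of_norm_inner_eq {x y : H} (h : ∀ i, ‖inner 𝕜 (Φ i) x‖ = ‖inner 𝕜 (Φ i) y‖) :
    ‖x‖ = ‖y‖ := by
  have hx := hasSum_norm_sq_inner Φ x
  simp only [h] at hx
  exact (sq_eq_sq₀ (norm_nonneg _) (norm_nonneg _)).1 (hx.unique (hasSum_norm_sq_inner Φ y))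

theorem hasSum_smul_iff_inner_eq {c : ι → 𝕜} {x : H} :
    HasSum (fun i => c i • Φ i) x ↔ ∀ i, c i = inner 𝕜 (Φ i) x := by
  refine ⟨fun h i => ?_, fun h => ?_⟩
  · have hi : HasSum (fun j => inner 𝕜 (Φ i) (c j • Φ j)) (inner 𝕜 (Φ i) x) :=
      h.mapL (innerSL 𝕜 (Φ i))
    rw [← hi.tsum_eq, tsum_eq_single i fun j hj => by
      rw [inner_smul_right, Φ.orthonormal.2 hj.symm, mul_zero], inner_smul_right,
      inner_self_eq_norm_sq_to_K, Φ.orthonormal.1, RCLike.ofReal_one, one_pow, mul_one]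
  · simpa only [h, Φ.repr_apply_apply] using Φ.hasSum_repr x

theorem exists_forall_inner_eq {a : ι → 𝕜} {g : H} {C : ℝ}
    (h : ∀ i, ‖a i‖ ≤ C * ‖inner 𝕜 (Φ i) g‖) : ∃ x, ∀ i, inner 𝕜 (Φ i) x = a i := by
  have hmem : Memℓp a 2 := by
    refine memℓp_gen ?_
    have hs := (hasSum_norm_sq_inner Φ g).summable.mul_left (C ^ 2)
    refine hs.of_nonneg_of_le (fun i => by positivity) fun i => ?_
    rw [ENNReal.toReal_ofNat, Real.rpow_two, ← mul_pow]
    gcongr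
    exact h i
  refine ⟨Φ.repr.symm ⟨a, hmem⟩, fun i => ?_⟩
  rw [← Φ.repr_apply_apply, LinearIsometryEquiv.apply_symm_apply]

theorem tendsto_of_forall_tendsto_inner {X : Type*} {f : Filter X} {w : X → H} {g z : H}
    (hw : ∀ x i, ‖inner 𝕜 (Φ i) (w x)‖ ≤ ‖inner 𝕜 (Φ i) g‖)
    (h : ∀ i, Filter.Tendsto (fun x => inner 𝕜 (Φ i) (w x)) f (nhds (inner 𝕜 (Φ i) z))) :
    Filter.Tendsto w f (nhds z) := by
  have hsq : ∀ x, ‖w x - z‖ ^ 2 = ∑' i, ‖inner 𝕜 (Φ i) (w x) - inner 𝕜 (Φ i) z‖ ^ 2 := fun x => by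
    simp only [← inner_sub_right, (hasSum_norm_sq_inner Φ (w x - z)).tsum_eq]
  have hlim : Filter.Tendsto (fun x => ‖w x - z‖ ^ 2) f (nhds 0) := by
    simp only [hsq]
    rw [← tsum_zero (β := ι)]
    refine tendsto_tsum_of_dominated_convergence
      (bound := fun i => 2 * (‖inner 𝕜 (Φ i) g‖ ^ 2 + ‖inner 𝕜 (Φ i) z‖ ^ 2))
      (((hasSum_norm_sq_inner Φ g).summable.add (hasSum_norm_sq_inner Φ z).summable).mul_left 2)
      (fun i => ?_) (.of_forall fun x i => ?_)
    · simpa using ((h i).sub_const (inner 𝕜 (Φ i) z)).norm.pow 2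
    · rw [Real.norm_of_nonneg (by positivity)]
      calc ‖inner 𝕜 (Φ i) (w x) - inner 𝕜 (Φ i) z‖ ^ 2
          ≤ (‖inner 𝕜 (Φ i) g‖ + ‖inner 𝕜 (Φ i) z‖) ^ 2 := by
            gcongr
            exact (norm_sub_le _ _).trans (by gcongr; exact hw x i)
        _ ≤ _ := add_sq_le
  rw [tendsto_iff_norm_sub_tendsto_zero]
  simpa using hlim.sqrt

end HilbertBasisCoefficients

/-! ### Symmetric operators and the scale of spaces -/

section SpectralScale

variable {ι H : Type*} [NormedAddCommGroup H] [InnerProductSpace ℂ H] {A : H →ₗ.[ℂ] H}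

theorem inner_apply_of_mem_eigSpace (hA : A.IsFormalAdjoint A) {r : ℝ} {e : H}
    (he : e ∈ eigSpace A r) (u : A.domain) : inner ℂ e (A u) = r * inner ℂ e (u : H) := by
  obtain ⟨h, h'⟩ := he
  rw [← hA ⟨e, h⟩ u, h', inner_smul_left, Complex.conj_ofReal]

theorem inner_eq_zero_of_mem_eigSpace_of_ne (hA : A.IsFormalAdjoint A) {r s : ℝ} (hrs : r ≠ s)
    {u v : H} (hu : u ∈ eigSpace A r) (hv : v ∈ eigSpace A s) : inner ℂ u v = 0 := by
  obtain ⟨h, h'⟩ := id hv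
  have huv : (s : ℂ) * inner ℂ u v = r * inner ℂ u v := by
    rw [← inner_smul_right, ← h', inner_apply_of_mem_eigSpace hA hu]
  refine (mul_eq_mul_right_iff.1 huv).resolve_left fun hsr => hrs ?_
  exact (Complex.ofReal_injective hsr).symm

theorem exists_eigenvalue_eq (hA : A.IsFormalAdjoint A) {lam : ι → ℝ} {Φ : HilbertBasis ι ℂ H}
    (hΦ : ∀ i, Φ i ∈ eigSpace A (lam i)) {r : ℝ} {u : H} (hu : u ∈ eigSpace A r) (hu₀ : u ≠ 0) :
    ∃ i, lam i = r := by
  by_contra! h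
  exact hu₀ (eq_of_forall_inner_eq Φ fun i => by
    rw [inner_eq_zero_of_mem_eigSpace_of_ne hA (h i) (hΦ i) hu, inner_zero_right])

variable [CompleteSpace H]

theorem eigProj_of_mem_eigSpace (hA : A.IsFormalAdjoint A) {r s : ℝ} {e : H}
    (he : e ∈ eigSpace A s) : eigProj A r e = if r = s then e else 0 := by
  split_ifs with h
  · subst h
    exact Submodule.starProjection_eq_self_iff.2 (Submodule.le_topologicalClosure _ he)
  · refine (Submodule.starProjection_apply_eq_zero_iff _).2 ?_
    rw [Submodule.orthogonal_closure, Submodule.mem_orthogonal]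
    exact fun u hu => inner_eq_zero_of_mem_eigSpace_of_ne hA h hu he

theorem inner_eigProj_of_mem_eigSpace (hA : A.IsFormalAdjoint A) {r s : ℝ} {e : H}
    (he : e ∈ eigSpace A s) (u : H) :
    inner ℂ e (eigProj A r u) = if r = s then inner ℂ e u else 0 := by
  have h : inner ℂ e (eigProj A r u) = inner ℂ (eigProj A r e) u :=
    (Submodule.inner_starProjection_left_eq_right _ _ _).symm
  rw [h, eigProj_of_mem_eigSpace hA he, apply_ite (inner ℂ · u), inner_zero_left]

theorem hasSum_rpow_smul_eigProj (hA : A.IsFormalAdjoint A) (θ : ℝ) {s : ℝ} {e : H}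
    (he : e ∈ eigSpace A s) :
    HasSum (fun r : ℝ => ((r ^ θ : ℝ) : ℂ) • eigProj A r e) (((s ^ θ : ℝ) : ℂ) • e) := by
  convert hasSum_single s fun r hr => ?_ using 1
  · rw [eigProj_of_mem_eigSpace hA he, if_pos rfl]
  · rw [eigProj_of_mem_eigSpace hA he, if_neg hr, smul_zero]

theorem mem_opPow_domain_of_mem_eigSpace (hA : A.IsFormalAdjoint A) (θ : ℝ) {s : ℝ} {e : H}
    (he : e ∈ eigSpace A s) : e ∈ (opPow A θ).domain :=
  (hasSum_rpow_smul_eigProj hA θ he).summable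

theorem inner_opPow (hA : A.IsFormalAdjoint A) {θ s : ℝ} {e : H} (he : e ∈ eigSpace A s)
    (u : (opPow A θ).domain) :
    inner ℂ e (opPow A θ u) = ((s ^ θ : ℝ) : ℂ) * inner ℂ e (u : H) := by
  have h : HasSum (fun r : ℝ => ((r ^ θ : ℝ) : ℂ) • eigProj A r (u : H)) (opPow A θ u) :=
    Summable.hasSum u.2
  refine (h.mapL (innerSL ℂ e)).unique ?_
  convert hasSum_single s fun r hr => ?_ using 1
  · rw [innerSL_apply_apply, inner_smul_right, inner_eigProj_of_mem_eigSpace hA he, if_pos rfl]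
  · rw [innerSL_apply_apply, inner_smul_right, inner_eigProj_of_mem_eigSpace hA he, if_neg hr,
      mul_zero]

/-- `A^θ` as an isometry of `D(A^θ)`, with the norm `‖A^θ u‖`, into `H`. -/
def preScaleIsometry (A : H →ₗ.[ℂ] H) (θ : ℝ) : PreScale A θ →ₗᵢ[ℂ] H :=
  { PreScale.pow A θ with norm_map' := fun _ => rfl }

/-- The extension of `A^θ` by continuity to an isometry of `𝓗_θ` into `H`. It is used to transport
statements about `𝓗_θ` to `H`. -/
def scaleIsometry (A : H →ₗ.[ℂ] H) (θ : ℝ) : Scale A θ →ₗᵢ[ℂ] H where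
  toLinearMap := ((preScaleIsometry A θ).toContinuousLinearMap.extend
    UniformSpace.Completion.toComplL).toLinearMap
  norm_map' x := by
    induction x using UniformSpace.Completion.induction_on with
    | hp => exact isClosed_eq (ContinuousLinearMap.continuous _).norm continuous_norm
    | ih u =>
      refine (congrArg norm (ContinuousLinearMap.extend_eq _
        UniformSpace.Completion.denseRange_coe
        (UniformSpace.Completion.isUniformInducing_coe _) u)).trans ?_
      rw [UniformSpace.Completion.norm_coe]
      exact (preScaleIsometry A θ).norm_map u

theorem scaleIsometry_coe (θ : ℝ) (u : PreScale A θ) :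
    scaleIsometry A θ u = PreScale.pow A θ u :=
  ContinuousLinearMap.extend_eq (preScaleIsometry A θ).toContinuousLinearMap
    (e := UniformSpace.Completion.toComplL) UniformSpace.Completion.denseRange_coe
    (UniformSpace.Completion.isUniformInducing_coe _) u

theorem scaleIsometry_toScale (hA : A.IsFormalAdjoint A) {θ s : ℝ} {e : H}
    (he : e ∈ eigSpace A s) (h : e ∈ (opPow A θ).domain) :
    scaleIsometry A θ (toScale A θ e h) = ((s ^ θ : ℝ) : ℂ) • e :=
  (scaleIsometry_coe θ _).trans (hasSum_rpow_smul_eigProj hA θ he).tsum_eq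

theorem ofReal_rpow_ne_zero {r : ℝ} (hr : 0 < r) (θ : ℝ) : ((r ^ θ : ℝ) : ℂ) ≠ 0 :=
  Complex.ofReal_ne_zero.2 (Real.rpow_pos_of_pos hr θ).ne'

variable {lam : ι → ℝ} {Φ : HilbertBasis ι ℂ H}

theorem scaleIsometry_surjective (hA : A.IsFormalAdjoint A) (hΦ : ∀ i, Φ i ∈ eigSpace A (lam i))
    (hpos : ∀ i, 0 < lam i) (θ : ℝ) : Function.Surjective (scaleIsometry A θ) := by
  have hclosed : IsClosed (LinearMap.range (scaleIsometry A θ).toLinearMap : Set H) := by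
    rw [LinearMap.coe_range]
    exact (scaleIsometry A θ).isometry.isClosedEmbedding.isClosed_range
  have hspan : Submodule.span ℂ (Set.range Φ) ≤ LinearMap.range (scaleIsometry A θ).toLinearMap :=
    Submodule.span_le.2 <| Set.range_subset_iff.2 fun i =>
      ⟨((lam i ^ θ : ℝ) : ℂ)⁻¹ •
          toScale A θ (Φ i) (mem_opPow_domain_of_mem_eigSpace hA θ (hΦ i)), by
        rw [map_smul, LinearIsometry.coe_toLinearMap, scaleIsometry_toScale hA (hΦ i),
          inv_smul_smul₀ (ofReal_rpow_ne_zero (hpos i) θ)]⟩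
  have htop := Submodule.topologicalClosure_minimal _ hspan hclosed
  rw [Φ.dense_span, top_le_iff] at htop
  exact LinearMap.range_eq_top.1 htop

theorem hasSum_smul_toScale_iff (hA : A.IsFormalAdjoint A) (hΦ : ∀ i, Φ i ∈ eigSpace A (lam i))
    (hpos : ∀ i, 0 < lam i) {θ : ℝ} (hdom : ∀ i, Φ i ∈ (opPow A θ).domain) {c : ι → ℂ}
    {x : Scale A θ} :
    HasSum (fun i => c i • toScale A θ (Φ i) (hdom i)) x ↔
      ∀ i, c i * ((lam i ^ θ : ℝ) : ℂ) = inner ℂ (Φ i) (scaleIsometry A θ x) := by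
  let e := (LinearIsometryEquiv.ofSurjective (scaleIsometry A θ)
    (scaleIsometry_surjective hA hΦ hpos θ)).toContinuousLinearEquiv
  have he : ∀ z, e z = scaleIsometry A θ z := fun _ => rfl
  rw [← hasSum_smul_iff_inner_eq Φ, ← he x, ← e.hasSum']
  simp only [he, map_smul, scaleIsometry_toScale hA (hΦ _), smul_smul]

theorem scalePairing_eq_inner {θ : ℝ} {φ ψ : H}
    (h : ∀ u : (opPow A θ).domain, inner ℂ φ (u : H) = inner ℂ ψ (opPow A θ u)) (x : Scale A θ) :
    scalePairing A θ φ x = inner ℂ ψ (scaleIsometry A θ x) := by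
  have hpre : (fun u : PreScale A θ => inner ℂ φ ((show ↥(opPow A θ).domain from u) : H)) =
      fun u => inner ℂ ψ (preScaleIsometry A θ u) := funext h
  have huc : UniformContinuous fun u : PreScale A θ => inner ℂ ψ (preScaleIsometry A θ u) :=
    (innerSL ℂ ψ).uniformContinuous.comp (preScaleIsometry A θ).isometry.uniformContinuous
  rw [scalePairing, hpre]
  induction x using UniformSpace.Completion.induction_on with
  | hp =>
    exact isClosed_eq UniformSpace.Completion.continuous_extension
      ((innerSL ℂ ψ).continuous.comp (scaleIsometry A θ).continuous)
  | ih u =>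
    rw [UniformSpace.Completion.extension_coe huc, scaleIsometry_coe]
    rfl

theorem ofReal_rpow_neg_mul_rpow {r : ℝ} (hr : 0 < r) (θ : ℝ) :
    ((r ^ (-θ) : ℝ) : ℂ) * ((r ^ θ : ℝ) : ℂ) = 1 := by
  rw [← Complex.ofReal_mul, ← Real.rpow_add hr, neg_add_cancel, Real.rpow_zero,
    Complex.ofReal_one]

theorem scalePairing_of_mem_eigSpace (hA : A.IsFormalAdjoint A) {r : ℝ} (hr : 0 < r) {θ : ℝ}
    {e : H} (he : e ∈ eigSpace A r) (x : Scale A θ) :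
    scalePairing A θ e x = ((r ^ (-θ) : ℝ) : ℂ) * inner ℂ e (scaleIsometry A θ x) := by
  rw [scalePairing_eq_inner (ψ := ((r ^ (-θ) : ℝ) : ℂ) • e) fun u => ?_, inner_smul_left,
    Complex.conj_ofReal]
  rw [inner_smul_left, Complex.conj_ofReal, inner_opPow hA he, ← mul_assoc,
    ofReal_rpow_neg_mul_rpow hr, one_mul]

theorem inner_eq_inner_opPow (hA : A.IsFormalAdjoint A) (hΦ : ∀ i, Φ i ∈ eigSpace A (lam i))
    (hpos : ∀ i, 0 < lam i) {θ : ℝ} {φ ψ : H}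
    (hψ : ∀ i, inner ℂ (Φ i) ψ = ((lam i ^ (-θ) : ℝ) : ℂ) * inner ℂ (Φ i) φ)
    (u : (opPow A θ).domain) : inner ℂ φ (u : H) = inner ℂ ψ (opPow A θ u) := by
  rw [← (Φ.hasSum_inner_mul_inner φ (u : H)).tsum_eq,
    ← (Φ.hasSum_inner_mul_inner ψ (opPow A θ u)).tsum_eq]
  refine tsum_congr fun i => ?_
  rw [inner_opPow hA (hΦ i), ← inner_conj_symm ψ, hψ, map_mul, Complex.conj_ofReal,
    inner_conj_symm]
  linear_combination
    -(inner ℂ φ (Φ i) * inner ℂ (Φ i) (u : H)) * ofReal_rpow_neg_mul_rpow (hpos i) θ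

end SpectralScale

/-! ### The unitary group and the Schrödinger equation -/

section Oscillation

theorem norm_exp_I_mul_ofReal_mul_ofReal (r t : ℝ) :
    ‖Complex.exp (Complex.I * r * t)‖ = 1 := by
  rw [mul_assoc, ← Complex.ofReal_mul, Complex.norm_exp_I_mul_ofReal]

theorem hasDerivAt_exp_mul_ofReal (a : ℂ) (t : ℝ) :
    HasDerivAt (fun s : ℝ => Complex.exp (a * s)) (Complex.exp (a * t) * a) t := by
  simpa using ((Complex.ofRealCLM.hasDerivAt (x := t)).const_mul a).cexp

theorem eq_exp_mul_of_hasDerivAt {a : ℂ} {g : ℝ → ℂ} {T t : ℝ}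
    (hgc : ContinuousOn g (Set.Icc 0 T)) (hg : ∀ s ∈ Set.Ioo 0 T, HasDerivAt g (a * g s) s)
    (ht : t ∈ Set.Icc 0 T) : g t = Complex.exp (a * t) * g 0 := by
  have hconst := intervalIntegral.integral_eq_sub_of_hasDeriv_right_of_le
    (f := fun s : ℝ => Complex.exp (-a * s) * g s) (f' := fun _ => 0) ht.1
    (ContinuousOn.mul (by fun_prop) (hgc.mono (Set.Icc_subset_Icc_right ht.2))) (fun s hs =>
      (((hasDerivAt_exp_mul_ofReal (-a) s).mul (hg s ⟨hs.1, hs.2.trans_le ht.2⟩)).congr_deriv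
        (by ring)).hasDerivWithinAt) intervalIntegrable_const
  rw [intervalIntegral.integral_zero, Complex.ofReal_zero, mul_zero, Complex.exp_zero, one_mul,
    eq_comm, sub_eq_zero] at hconst
  rw [← hconst, ← mul_assoc, ← Complex.exp_add, neg_mul, add_neg_cancel, Complex.exp_zero, one_mul]

theorem hasDerivAt_tsum_mul_exp {ι : Type*} {c : ι → ℂ} {lam : ι → ℝ} (hc : Summable c)
    (hlam : Summable fun i => lam i * c i) (t : ℝ) :
    HasDerivAt (fun s : ℝ => ∑' i, c i * Complex.exp (Complex.I * lam i * s))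
      (∑' i, c i * (Complex.exp (Complex.I * lam i * t) * (Complex.I * lam i))) t := by
  refine hasDerivAt_tsum (y₀ := 0) hlam.norm
    (fun i s => (hasDerivAt_exp_mul_ofReal (Complex.I * lam i) s).const_mul (c i))
    (fun i s => le_of_eq ?_) (by simpa using hc) t
  rw [norm_mul, norm_mul, norm_mul, norm_exp_I_mul_ofReal_mul_ofReal, Complex.norm_I, norm_mul]
  ring

end Oscillation

section UnitaryOrbit

variable {ι H : Type*} [NormedAddCommGroup H] [InnerProductSpace ℂ H]

theorem exists_unitary_orbit (Φ : HilbertBasis ι ℂ H) (lam : ι → ℝ) (h : H) :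
    ∃ w : ℝ → H, Continuous w ∧ ∀ t i, inner ℂ (Φ i) (w t) =
      Complex.exp (Complex.I * lam i * t) * inner ℂ (Φ i) h := by
  choose w hw using fun t : ℝ => exists_forall_inner_eq Φ (g := h) (C := 1)
    (a := fun i => Complex.exp (Complex.I * lam i * t) * inner ℂ (Φ i) h) fun i => by
      rw [norm_mul, norm_exp_I_mul_ofReal_mul_ofReal]
  refine ⟨w, continuous_iff_continuousAt.2 fun t => ?_, hw⟩
  refine tendsto_of_forall_tendsto_inner Φ (g := h) (fun s i => ?_) fun i => ?_
  · rw [hw, norm_mul, norm_exp_I_mul_ofReal_mul_ofReal, one_mul]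
  · simp only [hw]
    exact Continuous.tendsto (by fun_prop) t

theorem hasDerivAt_inner_orbit {lam : ι → ℝ} {Φ : HilbertBasis ι ℂ H} {w : ℝ → H} {h ψ ψ' : H}
    (hw : ∀ t i, inner ℂ (Φ i) (w t) =
      Complex.exp (Complex.I * lam i * (t : ℝ)) * inner ℂ (Φ i) h)
    (hψ : ∀ i, inner ℂ (Φ i) ψ' = (lam i : ℂ) * inner ℂ (Φ i) ψ) (t : ℝ) :
    HasDerivAt (fun s => inner ℂ ψ (w s)) (Complex.I * inner ℂ ψ' (w t)) t := by
  have hψ' : ∀ i, inner ℂ ψ' (Φ i) = (lam i : ℂ) * inner ℂ ψ (Φ i) := fun i => by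
    rw [← inner_conj_symm, hψ, map_mul, Complex.conj_ofReal, inner_conj_symm]
  have hseries : ∀ s, inner ℂ ψ (w s) =
      ∑' i, inner ℂ ψ (Φ i) * inner ℂ (Φ i) h * Complex.exp (Complex.I * lam i * s) := fun s => by
    rw [← (Φ.hasSum_inner_mul_inner ψ (w s)).tsum_eq]
    exact tsum_congr fun i => by rw [hw]; ring
  have hsummable : Summable fun i => lam i * (inner ℂ ψ (Φ i) * inner ℂ (Φ i) h) := by
    simpa only [hψ', mul_assoc] using (Φ.hasSum_inner_mul_inner ψ' h).summable
  refine ((hasDerivAt_tsum_mul_exp (Φ.hasSum_inner_mul_inner ψ h).summable hsummable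
    t).congr_of_eventuallyEq (.of_forall hseries)).congr_deriv ?_
  rw [← (Φ.hasSum_inner_mul_inner ψ' (w t)).tsum_eq, ← tsum_mul_left]
  refine tsum_congr fun i => ?_
  rw [hψ', hw]
  ring

end UnitaryOrbit

section SmoothVectors

variable {ι H : Type*} [NormedAddCommGroup H] [InnerProductSpace ℂ H] {A : H →ₗ.[ℂ] H}

theorem mem_smoothVectors_of_mem_eigSpace {r : ℝ} {e : H} (he : e ∈ eigSpace A r) :
    e ∈ smoothVectors A := by
  refine ⟨fun k => ((r : ℂ) ^ k) • e, by simp, fun k => ?_⟩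
  obtain ⟨h, h'⟩ := (eigSpace A r).smul_mem ((r : ℂ) ^ k) he
  exact ⟨h, h'.trans (by rw [smul_smul, ← pow_succ'])⟩

theorem apply_mem_smoothVectors {φ : H} (hφ : φ ∈ smoothVectors A) :
    A ⟨φ, smoothVectors_subset_domain A hφ⟩ ∈ smoothVectors A := by
  obtain ⟨f, rfl, hf⟩ := id hφ
  exact ⟨fun k => f (k + 1), (hf 0).2.symm, fun k => hf (k + 1)⟩

theorem exists_forall_inner_eq_pow_mul (hA : A.IsFormalAdjoint A) {φ : H}
    (hφ : φ ∈ smoothVectors A) (k : ℕ) :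
    ∃ g : H, ∀ (r : ℝ), ∀ e ∈ eigSpace A r, inner ℂ e g = (r : ℂ) ^ k * inner ℂ e φ := by
  obtain ⟨f, rfl, hf⟩ := hφ
  refine ⟨f k, fun r e he => ?_⟩
  induction k with
  | zero => rw [pow_zero, one_mul]
  | succ k ih =>
    obtain ⟨h, h'⟩ := hf k
    rw [← h', inner_apply_of_mem_eigSpace hA he, ih, pow_succ', mul_assoc]

theorem rpow_le_mul_pow {c x s : ℝ} {k : ℕ} (hc : 0 < c) (hcx : c ≤ x) (hk : s ≤ k) :
    x ^ s ≤ c ^ (s - k) * x ^ k := by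
  have hx := hc.trans_le hcx
  calc x ^ s = x ^ (s - k) * x ^ k := by
        rw [← Real.rpow_natCast x k, ← Real.rpow_add hx, sub_add_cancel]
    _ ≤ c ^ (s - k) * x ^ k := mul_le_mul_of_nonneg_right
        (Real.rpow_le_rpow_of_nonpos hc hcx (sub_nonpos.2 hk)) (pow_nonneg hx.le k)

theorem exists_forall_inner_eq_rpow_mul (hA : A.IsFormalAdjoint A) {lam : ι → ℝ}
    {Φ : HilbertBasis ι ℂ H} (hΦ : ∀ i, Φ i ∈ eigSpace A (lam i)) {c : ℝ} (hc : 0 < c)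
    (hlam : ∀ i, c ≤ lam i) (s : ℝ) {φ : H} (hφ : φ ∈ smoothVectors A) :
    ∃ ψ : H, ∀ i, inner ℂ (Φ i) ψ = ((lam i ^ s : ℝ) : ℂ) * inner ℂ (Φ i) φ := by
  obtain ⟨k, hk⟩ := exists_nat_ge s
  obtain ⟨g, hg⟩ := exists_forall_inner_eq_pow_mul hA hφ k
  refine exists_forall_inner_eq Φ (g := g) (C := c ^ (s - k)) fun i => ?_
  have hi := hc.trans_le (hlam i)
  rw [hg _ _ (hΦ i), norm_mul, norm_mul, norm_pow,
    Complex.norm_of_nonneg (Real.rpow_nonneg hi.le s), Complex.norm_of_nonneg hi.le, ← mul_assoc]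
  gcongr
  exact rpow_le_mul_pow hc (hlam i) hk

end SmoothVectors

section Schrodinger

variable {ι H : Type*} [NormedAddCommGroup H] [InnerProductSpace ℂ H] [CompleteSpace H]
  {A : H →ₗ.[ℂ] H} {lam : ι → ℝ} {Φ : HilbertBasis ι ℂ H} {θ T : ℝ} {hT : 0 < T}
  {y₀ : Scale A θ} {y z : C(Set.Icc (0 : ℝ) T, Scale A θ)}

namespace IsSchrodingerSolution

theorem inner_eq (hy : IsSchrodingerSolution A θ hT y₀ y) (hA : A.IsFormalAdjoint A) {r : ℝ}
    (hr : 0 < r) {e : H} (he : e ∈ eigSpace A r) (t : Set.Icc (0 : ℝ) T) :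
    inner ℂ e (scaleIsometry A θ (y t)) =
      Complex.exp (Complex.I * r * (t : ℝ)) * inner ℂ e (scaleIsometry A θ y₀) := by
  let p : ℝ → Scale A θ := fun s => y (Set.projIcc 0 T hT.le s)
  let g : ℝ → ℂ := fun s => scalePairing A θ e (p s)
  have hgp : ∀ s, g s = ((r ^ (-θ) : ℝ) : ℂ) * inner ℂ e (scaleIsometry A θ (p s)) := fun s =>
    scalePairing_of_mem_eigSpace hA hr he (p s)
  have hgc : Continuous g := UniformSpace.Completion.continuous_extension.comp
    (y.continuous.comp continuous_projIcc)
  have hgd : ∀ s ∈ Set.Ioo 0 T, HasDerivAt g (Complex.I * r * g s) s := fun s hs => by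
    refine (hy.2 e (mem_smoothVectors_of_mem_eigSpace he) s hs).congr_deriv ?_
    obtain ⟨hdom, hAe⟩ := id he
    rw [hgp, hAe, scalePairing_of_mem_eigSpace hA hr ((eigSpace A r).smul_mem r he),
      inner_smul_left, Complex.conj_ofReal]
    ring
  have hp₀ : p 0 = y₀ := by rw [← hy.1]; exact congrArg y (Set.projIcc_left hT.le)
  have hpt : p t = y t := congrArg y (Set.projIcc_val hT.le t)
  have hgt := eq_exp_mul_of_hasDerivAt hgc.continuousOn hgd t.2
  rw [hgp, hgp, hp₀, hpt, mul_left_comm] at hgt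
  exact mul_left_cancel₀ (ofReal_rpow_ne_zero hr (-θ)) hgt

theorem unique (hy : IsSchrodingerSolution A θ hT y₀ y) (hz : IsSchrodingerSolution A θ hT y₀ z)
    (hA : A.IsFormalAdjoint A) (hΦ : ∀ i, Φ i ∈ eigSpace A (lam i)) (hpos : ∀ i, 0 < lam i) :
    z = y := by
  ext t : 1
  refine (scaleIsometry A θ).injective (eq_of_forall_inner_eq Φ fun i => ?_)
  rw [hy.inner_eq hA (hpos i) (hΦ i), hz.inner_eq hA (hpos i) (hΦ i)]

theorem norm_eq (hy : IsSchrodingerSolution A θ hT y₀ y) (hA : A.IsFormalAdjoint A)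
    (hΦ : ∀ i, Φ i ∈ eigSpace A (lam i)) (hpos : ∀ i, 0 < lam i) (t : Set.Icc (0 : ℝ) T) :
    ‖y t‖ = ‖y₀‖ := by
  rw [← (scaleIsometry A θ).norm_map, ← (scaleIsometry A θ).norm_map y₀]
  refine norm_eq_of_norm_inner_eq Φ fun i => ?_
  rw [hy.inner_eq hA (hpos i) (hΦ i), norm_mul, norm_exp_I_mul_ofReal_mul_ofReal, one_mul]

theorem hasSum (hy : IsSchrodingerSolution A θ hT y₀ y) (hA : A.IsFormalAdjoint A)
    (hΦ : ∀ i, Φ i ∈ eigSpace A (lam i)) (hpos : ∀ i, 0 < lam i)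
    (hdom : ∀ i, Φ i ∈ (opPow A θ).domain) {c : ι → ℂ}
    (hc : HasSum (fun i => c i • toScale A θ (Φ i) (hdom i)) y₀) (t : Set.Icc (0 : ℝ) T) :
    HasSum (fun i => (c i * Complex.exp (Complex.I * lam i * (t : ℝ))) •
      toScale A θ (Φ i) (hdom i)) (y t) := by
  rw [hasSum_smul_toScale_iff hA hΦ hpos] at hc ⊢
  intro i
  rw [hy.inner_eq hA (hpos i) (hΦ i), ← hc i]
  ring

end IsSchrodingerSolution

theorem exists_hasSum_smul_toScale (hA : A.IsFormalAdjoint A)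
    (hΦ : ∀ i, Φ i ∈ eigSpace A (lam i)) (hpos : ∀ i, 0 < lam i)
    (hdom : ∀ i, Φ i ∈ (opPow A θ).domain) (x : Scale A θ) :
    ∃ c : ι → ℂ, HasSum (fun i => c i • toScale A θ (Φ i) (hdom i)) x :=
  ⟨fun i => inner ℂ (Φ i) (scaleIsometry A θ x) / ((lam i ^ θ : ℝ) : ℂ),
    (hasSum_smul_toScale_iff hA hΦ hpos hdom).2 fun i =>
      div_mul_cancel₀ _ (ofReal_rpow_ne_zero (hpos i) θ)⟩

theorem exists_isSchrodingerSolution (hA : A.IsFormalAdjoint A)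
    (hΦ : ∀ i, Φ i ∈ eigSpace A (lam i)) {c : ℝ} (hc : 0 < c) (hlam : ∀ i, c ≤ lam i)
    (hT : 0 < T) (y₀ : Scale A θ) :
    ∃ y : C(Set.Icc (0 : ℝ) T, Scale A θ), IsSchrodingerSolution A θ hT y₀ y := by
  have hpos : ∀ i, 0 < lam i := fun i => hc.trans_le (hlam i)
  obtain ⟨w, hwc, hw⟩ := exists_unitary_orbit Φ lam (scaleIsometry A θ y₀)
  let e := LinearIsometryEquiv.ofSurjective (scaleIsometry A θ)
    (scaleIsometry_surjective hA hΦ hpos θ)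
  have he : ∀ x, scaleIsometry A θ (e.symm x) = x := e.apply_symm_apply
  refine ⟨⟨fun t => e.symm (w t), e.symm.continuous.comp (hwc.comp continuous_subtype_val)⟩,
    e.symm_apply_eq.2 (eq_of_forall_inner_eq Φ fun i => ?_), fun φ hφ t ht => ?_⟩
  · change inner ℂ (Φ i) (w 0) = inner ℂ (Φ i) (scaleIsometry A θ y₀)
    rw [hw, Complex.ofReal_zero, mul_zero, Complex.exp_zero, one_mul]
  · obtain ⟨ψ, hψ⟩ := exists_forall_inner_eq_rpow_mul hA hΦ hc hlam (-θ) hφ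
    obtain ⟨ψ', hψ'⟩ :=
      exists_forall_inner_eq_rpow_mul hA hΦ hc hlam (-θ) (apply_mem_smoothVectors hφ)
    have hψψ' : ∀ i, inner ℂ (Φ i) ψ' = (lam i : ℂ) * inner ℂ (Φ i) ψ := fun i => by
      rw [hψ', hψ, inner_apply_of_mem_eigSpace hA (hΦ i), mul_left_comm]
    have hproj : ∀ s ∈ Set.Ioo 0 T, ((Set.projIcc 0 T hT.le s : Set.Icc 0 T) : ℝ) = s :=
      fun s hs => by rw [Set.projIcc_of_mem hT.le (Set.Ioo_subset_Icc_self hs)]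
    simp only [scalePairing_eq_inner (inner_eq_inner_opPow hA hΦ hpos hψ),
      scalePairing_eq_inner (inner_eq_inner_opPow hA hΦ hpos hψ'), ContinuousMap.coe_mk, he,
      hproj t ht]
    refine (hasDerivAt_inner_orbit hw hψψ' t).congr_of_eventuallyEq ?_
    filter_upwards [Ioo_mem_nhds ht.1 ht.2] with s hs
    rw [hproj s hs]

end Schrodinger

/-! ### The inverse of the clamped operator -/

section Inverse

variable {H : Type*} [NormedAddCommGroup H] [InnerProductSpace ℂ H] {A : H →ₗ.[ℂ] H}
  {K : H →L[ℂ] H}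

theorem injective_of_mem_graph_iff (hK : ∀ u f, (u, f) ∈ A.graph ↔ u = K f) :
    Function.Injective K :=
  (injective_iff_map_eq_zero K).2 fun f hf =>
    A.graph_fst_eq_zero_snd ((hK (K f) f).2 rfl) hf

theorem isFormalAdjoint_of_mem_graph_iff (hsymm : K.IsSymmetric)
    (hK : ∀ u f, (u, f) ∈ A.graph ↔ u = K f) : A.IsFormalAdjoint A := fun u v => by
  have hinv : ∀ x : A.domain, (x : H) = K (A x) := fun x => (hK _ _).1 (A.mem_graph x)
  rw [hinv u, hinv v]
  exact (hsymm _ _).symm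

theorem mem_eigSpace_of_mem_graph_iff (hK : ∀ u f, (u, f) ∈ A.graph ↔ u = K f) {r : ℝ} {e : H}
    (he : K ((r : ℂ) • e) = e) : e ∈ eigSpace A r := by
  obtain ⟨y, rfl, hy⟩ := A.mem_graph_iff.1 ((hK e _).2 he.symm)
  exact ⟨y.2, hy⟩

theorem exists_isEigenbasis [CompleteSpace H] (hcomp : IsCompactOperator K) (hpos : K.IsPositive)
    (hK : ∀ u f, (u, f) ∈ A.graph ↔ u = K f) (hdim : ¬ FiniteDimensional ℂ H) :
    ∃ (lam : ℕ → ℝ) (Φ : HilbertBasis ℕ ℂ H), IsEigenbasis A lam Φ ∧ (∀ n, 0 < lam n) ∧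
      Filter.Tendsto lam Filter.atTop Filter.atTop := by
  obtain ⟨lam, Φ, hmono, hlam, htend, hΦ⟩ :=
    exists_monotone_eigenbasis hcomp hpos (injective_of_mem_graph_iff hK) hdim
  exact ⟨lam, Φ, ⟨hmono, fun n => mem_eigSpace_of_mem_graph_iff hK (hΦ n)⟩, hlam, htend⟩

end Inverse

theorem exists_inverse_clampedOperator {ℓ c : ℝ} {ρ σ q : ℝ → ℝ} (hℓ : 0 < ℓ)
    (hρ : MemLp ρ ⊤ (intervalMeasure ℓ)) (hpos : ∀ᵐ x ∂intervalMeasure ℓ, 0 < ρ x)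
    (hσ : MemSobolev ℓ 2 σ) (hc : 0 < c) (hσ₀ : ∀ x ∈ Set.Icc 0 ℓ, c ≤ σ x)
    (hq : MemSobolev ℓ 1 q) (hq₀ : ∀ x ∈ Set.Icc 0 ℓ, 0 ≤ q x) :
    ∃ K : WeightedL2 ℓ ρ →L[ℂ] WeightedL2 ℓ ρ, IsCompactOperator K ∧ K.IsPositive ∧
      ∀ u f, (u, f) ∈ (clampedOperator ℓ ρ σ q).graph ↔ u = K f := by
  obtain ⟨K, hcomp, hKpos, hK⟩ := exists_isPositive_clampedSolution hℓ.le hρ hpos hσ hc hσ₀ hq hq₀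
  refine ⟨K, hcomp, hKpos, ?_⟩
  have hgraph : ∀ p ∈ clampedGraph ℓ ρ σ q, p.1 = 0 → p.2 = 0 := by
    rintro ⟨_, f⟩ hp rfl
    exact eq_zero_of_zero_mem_clampedGraph hℓ hρ hpos hσ
      (fun x hx => (hc.trans_le (hσ₀ x hx)).ne') hq hp
  rwa [clampedOperator, Submodule.toLinearPMap_graph_eq _ hgraph]

end

theorem proposition2p2_general (ℓ T : ℝ) (hℓ : 0 < ℓ) (hT : 0 < T) (ρ σ q : ℝ → ℝ)
    (hρ : MemLp ρ ⊤ (intervalMeasure ℓ)) (hρpos : ∀ᵐ x ∂intervalMeasure ℓ, 0 < ρ x)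
    (hσ : MemSobolev ℓ 2 σ) (hq : MemSobolev ℓ 1 q)
    (hσ₀ : ∃ σ₀ > 0, ∀ x ∈ Set.Icc 0 ℓ, σ₀ ≤ σ x)
    (hq₀ : ∀ x ∈ Set.Icc 0 ℓ, 0 ≤ q x) :
    (∃ (lam : ℕ → ℝ) (Φ : HilbertBasis ℕ ℂ (WeightedL2 ℓ ρ)),
      IsEigenbasis (clampedOperator ℓ ρ σ q) lam Φ ∧ 0 < lam 0 ∧
        Filter.Tendsto lam Filter.atTop Filter.atTop) ∧
    ∀ (θ : ℝ) (y₀ : Scale (clampedOperator ℓ ρ σ q) θ),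
      ∃ y : C(Set.Icc (0 : ℝ) T, Scale (clampedOperator ℓ ρ σ q) θ),
        IsSchrodingerSolution (clampedOperator ℓ ρ σ q) θ hT y₀ y ∧
        (∀ z : C(Set.Icc (0 : ℝ) T, Scale (clampedOperator ℓ ρ σ q) θ),
          IsSchrodingerSolution (clampedOperator ℓ ρ σ q) θ hT y₀ z → z = y) ∧
        (∀ (lam : ℕ → ℝ) (Φ : HilbertBasis ℕ ℂ (WeightedL2 ℓ ρ)),
          IsEigenbasis (clampedOperator ℓ ρ σ q) lam Φ →
          ∃ hΦ : ∀ n, Φ n ∈ (opPow (clampedOperator ℓ ρ σ q) θ).domain,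
            (∃ c : ℕ → ℂ,
              HasSum (fun n => c n • toScale (clampedOperator ℓ ρ σ q) θ (Φ n) (hΦ n)) y₀) ∧
            ∀ c : ℕ → ℂ,
              HasSum (fun n => c n • toScale (clampedOperator ℓ ρ σ q) θ (Φ n) (hΦ n)) y₀ →
              ∀ t : Set.Icc (0 : ℝ) T,
                HasSum (fun n => (c n * Complex.exp (Complex.I * lam n * (t : ℝ))) •
                  toScale (clampedOperator ℓ ρ σ q) θ (Φ n) (hΦ n)) (y t)) ∧
        ∀ t : Set.Icc (0 : ℝ) T, ‖y t‖ ^ 2 = ‖y₀‖ ^ 2 := by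
  obtain ⟨σ₀, hσ₀, hσle⟩ := hσ₀
  obtain ⟨K, hcomp, hKpos, hK⟩ :=
    exists_inverse_clampedOperator hℓ hρ hρpos hσ hσ₀ hσle hq hq₀
  have hA := isFormalAdjoint_of_mem_graph_iff hKpos.isSymmetric hK
  obtain ⟨lam₀, Φ₀, hΦ₀, hpos, htend⟩ := exists_isEigenbasis hcomp hKpos hK
    (not_finiteDimensional_weightedL2 hℓ hρ hρpos)
  refine ⟨⟨lam₀, Φ₀, hΦ₀, hpos 0, htend⟩, fun θ y₀ => ?_⟩
  obtain ⟨y, hy⟩ := exists_isSchrodingerSolution hA hΦ₀.2 (hpos 0)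
    (fun n => hΦ₀.1 (Nat.zero_le n)) hT y₀
  refine ⟨y, hy, fun z hz => hy.unique hz hA hΦ₀.2 hpos, fun lam Φ hΦ => ?_,
    fun t => by rw [hy.norm_eq hA hΦ₀.2 hpos]⟩
  have hlam : ∀ n, 0 < lam n := fun n => by
    obtain ⟨m, hm⟩ := exists_eigenvalue_eq hA hΦ₀.2 (hΦ.2 n) (Φ.orthonormal.ne_zero n)
    exact hm ▸ hpos m
  have hdom := fun n => mem_opPow_domain_of_mem_eigSpace hA θ (hΦ.2 n)
  exact ⟨hdom, exists_hasSum_smul_toScale hA hΦ.2 hlam hdom y₀,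
    fun c hc t => hy.hasSum hA hΦ.2 hlam hdom hc t⟩

theorem proposition2p2 (ℓ T : ℝ) (hℓ : 0 < ℓ) (hT : 0 < T) (ρ σ q : ℝ → ℝ)
    (hρ : MemSobolev ℓ 2 ρ) (hσ : MemSobolev ℓ 2 σ) (hq : MemSobolev ℓ 1 q)
    (hρ₀ : ∃ ρ₀ > 0, ∀ x ∈ Set.Icc 0 ℓ, ρ₀ ≤ ρ x)
    (hσ₀ : ∃ σ₀ > 0, ∀ x ∈ Set.Icc 0 ℓ, σ₀ ≤ σ x)
    (hq₀ : ∀ x ∈ Set.Icc 0 ℓ, 0 ≤ q x) :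
    -- the operator has an orthonormal basis of eigenfunctions
    (∃ (lam : ℕ → ℝ) (Φ : HilbertBasis ℕ ℂ (WeightedL2 ℓ ρ)),
      IsEigenbasis (clampedOperator ℓ ρ σ q) lam Φ ∧ 0 < lam 0 ∧
        Filter.Tendsto lam Filter.atTop Filter.atTop) ∧
    ∀ (θ : ℝ) (y₀ : Scale (clampedOperator ℓ ρ σ q) θ),
      ∃ y : C(Set.Icc (0 : ℝ) T, Scale (clampedOperator ℓ ρ σ q) θ),
        -- existence and uniqueness
        IsSchrodingerSolution (clampedOperator ℓ ρ σ q) θ hT y₀ y ∧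
        (∀ z : C(Set.Icc (0 : ℝ) T, Scale (clampedOperator ℓ ρ σ q) θ),
          IsSchrodingerSolution (clampedOperator ℓ ρ σ q) θ hT y₀ z → z = y) ∧
        -- the Fourier series
        (∀ (lam : ℕ → ℝ) (Φ : HilbertBasis ℕ ℂ (WeightedL2 ℓ ρ)),
          IsEigenbasis (clampedOperator ℓ ρ σ q) lam Φ →
          ∃ hΦ : ∀ n, Φ n ∈ (opPow (clampedOperator ℓ ρ σ q) θ).domain,
            (∃ c : ℕ → ℂ,
              HasSum (fun n => c n • toScale (clampedOperator ℓ ρ σ q) θ (Φ n) (hΦ n)) y₀) ∧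
            ∀ c : ℕ → ℂ,
              HasSum (fun n => c n • toScale (clampedOperator ℓ ρ σ q) θ (Φ n) (hΦ n)) y₀ →
              ∀ t : Set.Icc (0 : ℝ) T,
                HasSum (fun n => (c n * Complex.exp (Complex.I * lam n * (t : ℝ))) •
                  toScale (clampedOperator ℓ ρ σ q) θ (Φ n) (hΦ n)) (y t)) ∧
        -- conservation of the energy
        ∀ t : Set.Icc (0 : ℝ) T, ‖y t‖ ^ 2 = ‖y₀‖ ^ 2 := by
  obtain ⟨ρ₀, hρ₀, hρle⟩ := hρ₀
  exact proposition2p2_general ℓ T hℓ hT ρ σ q (memLp_of_continuousOn hρ.continuousOn ⊤)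
    (ae_restrict_of_forall_mem measurableSet_Ioo fun x hx =>
      hρ₀.trans_le (hρle x (Set.Ioo_subset_Icc_self hx))) hσ hq hσ₀ hq₀
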